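/- **Setting.** Let $n\ge 2$, let $x_1,\dots,x_n\in\mathbb R^d$, let $0<\eta<1-\frac1n$, and let $$F(c)=\sum_{i=1}^n\max\Bigl(0,\ \|x_i-c\|^2-\frac{\eta}{n-1}\sum_{j=1}^n\|x_j-c\|^2\Bigr).$$ Put $\eta'=\frac{n}{n-1}\eta$ and $\bar x=\frac1n\sum_j x_j$. The $i$-th summand vanishes exactly on the ball (sink region) bounded by the sink sphere $S_i=\{x:\ f_i(x)=0\}$, where $f_i(x)=\|x-c_i\|^2-R_i^2$, $$c_i=\frac{x_i-\eta'\bar x}{1-\eta'},\qquad R_i^2=\|c_i\|^2-\frac{\|x_i\|^2-\frac{\eta'}{n}\sum_j\|x_j\|^2}{1-\eta'} .$$ For $x\in\mathbb R^d$ let $I^+(x),I^0(x),I^-(x)$ be the sets of indices $i$ with $f_i(x)>0$, $=0$, $<0$. The cells are the classes of points with the same three sets. For a set $J$ of indices, put $f_J=\sum_{i\in J}f_i$, $S_J=\bigcap_{i\in J}S_i$, $c_J=\frac1{\#J}\sum_{i\in J}c_i$. Let $(\alpha_i)_{i\in I^0(x)}$ minimize $\bigl\|\nabla f_{I^+(x)}(x)+\sum_{i\in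 I^0(x)}\lambda_i\nabla f_i(x)\bigr\|$ over $0\le\lambda_i\le1$ (the Clarke QP at $x$), and let $\nabla_*F(x)=\nabla f_{I^+(x)}(x)+\sum_{i\in I^0(x)}\alpha_i\nabla f_i(x)$. Let $I^0_*(x)=\{i\in I^0(x):0<\alpha_i<1\}$, $I^+_*(x)=I^+(x)\cup\{i\in I^0(x):\alpha_i=1\}$, $I^-_*(x)=I^-(x)\cup\{i\in I^0(x):\alpha_i=0\}$, and let $\mathcal C^*(x)$ be the cell with these three sets. The Clarke QP at $x$ is *non-degenerate* if $I^0_*(x)=\{i\in I^0(x):\langle\nabla_*F(x),\nabla f_i(x)\rangle=0\}$. **Algorithm.** One step (one pass through the main loop) at the current point $x$: 1. If $I^0(x)=\emptyset$: if $c_{I^+(x)}$ lies in the cell of $x$, move to it and stop; otherwise move to the first point at which the half-line from $x$ towards $c_{I^+(x)}$ leaves the cell of $x$. 2. If $I^0(x)\ne\emptyset$ and $\nabla_*F(x)=0$: stop at $x$. 3. If $I^0(x)\neq\emptyset$, $\nabla_*F(x)\ne0$ and $I^0_*(x)=\emptyset$: if $c_{I^+_*(x)}\in\mathcal C^*(x)$,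 move to it and stop; otherwise move to the first point at which the half-line from $x$ towards $c_{I^+_*(x)}$ leaves $\mathcal C^*(x)$. 4. If $\nabla_*F(x)\ne0$ and $I^0_*(x)\ne\emptyset$: let $y$ be the minimizer of $f_{I^+_*(x)}$ on $S_{I^0_*(x)}$. If $y\in\mathcal C^*(x)$, move to $y$. Otherwise let $c_S,R_S$ be the center and radius of the sphere $S_{I^0_*(x)}$ ($c_S$ in the affine hull of the $c_i$, $i\in I^0_*(x)$), and move to the first point at which the geodesic $t\mapsto c_S+R_S\frac{(1-t)x+ty-c_S}{\|(1-t)x+ty-c_S\|}$, $t\in[0,1]$, leaves $\mathcal C^*(x)$. **Theorem (Algorithm convergence).** Let $x^*$ be the minimizer of $F$, and let $c=\#I^0(x^*)$ be the number of sink spheres on which $x^*$ lies. Assume that the sink spheres are in generic position in the following sense: they intersect transversally (for every $x\in\mathbb R^d$ the vectors $\nabla f_i(x)$, $i\in I^0(x)$, are linearly independent), and the Clarke QP is non-degenerate at every point of some neighborhood of $x^*$. Then there is a neighborhood $U$ of $x^*$ such that, from any starting point in $U$, the algorithm stops after at most $3^c$ steps, and it stops at the point $x^*$. -/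

import Mathlib

open Filter Topology

noncomputable section

/-- The cost `F_η(c) = ∑ᵢ max (0, ‖xᵢ - c‖² - η / (n - 1) * ∑ⱼ ‖xⱼ - c‖²)` of a data set. -/
def sphericalCost {d n : ℕ} (η : ℝ) (X : Fin n → EuclideanSpace ℝ (Fin d))
    (c : EuclideanSpace ℝ (Fin d)) : ℝ :=
  ∑ i, max 0 (‖X i - c‖ ^ 2 - η / ((n : ℝ) - 1) * ∑ j, ‖X j - c‖ ^ 2)

/-- A finite family of spheres `‖x - cᵢ‖² = Rᵢ²` in `ℝᵈ`, given by centers and squared radii. -/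
structure SphereArrangement (d n : ℕ) where
  center : Fin n → EuclideanSpace ℝ (Fin d)
  radiusSq : Fin n → ℝ

/-- The spheres bounding the sink regions
`{c | ‖xᵢ - c‖² - η / (n - 1) * ∑ⱼ ‖xⱼ - c‖² ≤ 0}` of a data set: with `η' = η n / (n - 1)`
and `x̄` the mean of the data,
`cᵢ = (xᵢ - η' x̄) / (1 - η')` and
`Rᵢ² = ‖cᵢ‖² - (‖xᵢ‖² - (η' / n) ∑ⱼ ‖xⱼ‖²) / (1 - η')`. -/
def sinkSpheres {d n : ℕ} (η : ℝ) (X : Fin n → EuclideanSpace ℝ (Fin d)) :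
    SphereArrangement d n :=
  let η' : ℝ := η * n / ((n : ℝ) - 1)
  let xbar : EuclideanSpace ℝ (Fin d) := (n : ℝ)⁻¹ • ∑ j, X j
  let c : Fin n → EuclideanSpace ℝ (Fin d) := fun i => (1 - η')⁻¹ • (X i - η' • xbar)
  { center := c
    radiusSq := fun i =>
      ‖c i‖ ^ 2 - (‖X i‖ ^ 2 - η' / n * ∑ j, ‖X j‖ ^ 2) / (1 - η') }

namespace SphereArrangement

variable {d n : ℕ} (S : SphereArrangement d n)

/-- The power `fᵢ(x) = ‖x - cᵢ‖² - Rᵢ²` of `x` with respect to the `i`-th sphere. -/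
def power (i : Fin n) (x : EuclideanSpace ℝ (Fin d)) : ℝ :=
  ‖x - S.center i‖ ^ 2 - S.radiusSq i

/-- The gradient `∇fᵢ(x) = 2 (x - cᵢ)`. -/
def grad (i : Fin n) (x : EuclideanSpace ℝ (Fin d)) : EuclideanSpace ℝ (Fin d) :=
  (2 : ℝ) • (x - S.center i)

open Classical in
/-- `I⁺(x)`: indices of the spheres having `x` outside. -/
def Ipos (x : EuclideanSpace ℝ (Fin d)) : Finset (Fin n) :=
  Finset.univ.filter fun i => 0 < S.power i x

open Classical in
/-- `I⁰(x)`: indices of the spheres through `x`. -/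
def Izero (x : EuclideanSpace ℝ (Fin d)) : Finset (Fin n) :=
  Finset.univ.filter fun i => S.power i x = 0

open Classical in
/-- `I⁻(x)`: indices of the spheres having `x` inside. -/
def Ineg (x : EuclideanSpace ℝ (Fin d)) : Finset (Fin n) :=
  Finset.univ.filter fun i => S.power i x < 0

/-- The cell of the arrangement with sign sets `P`, `Z`, `N`. -/
def cell (P Z N : Finset (Fin n)) : Set (EuclideanSpace ℝ (Fin d)) :=
  {x | S.Ipos x = P ∧ S.Izero x = Z ∧ S.Ineg x = N}

/-- `c_J`, the center of mass of the centers with index in `J`. -/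
def centroid (J : Finset (Fin n)) : EuclideanSpace ℝ (Fin d) :=
  (J.card : ℝ)⁻¹ • ∑ i ∈ J, S.center i

/-- `f_J = ∑_{i ∈ J} fᵢ`. -/
def powerSum (J : Finset (Fin n)) (x : EuclideanSpace ℝ (Fin d)) : ℝ :=
  ∑ i ∈ J, S.power i x

/-- `S_J`, the intersection of the spheres with index in `J`. -/
def sphereInter (J : Finset (Fin n)) : Set (EuclideanSpace ℝ (Fin d)) :=
  {x | ∀ i ∈ J, S.power i x = 0}

/-- Whenever spheres of the family meet, they meet transversally: at every point, the normals
of the spheres through that point are linearly independent. -/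
def Transverse : Prop :=
  ∀ x : EuclideanSpace ℝ (Fin d),
    LinearIndependent ℝ (fun i : {i : Fin n // S.power i x = 0} => S.grad i x)

/-- The element `∇f_{I⁺(x)}(x) + ∑_{i ∈ I⁰(x)} lᵢ ∇fᵢ(x)` of the Clarke gradient, `l ∈ [0,1]ⁿ`
(the coordinates of `l` outside `I⁰(x)` play no role). -/
def clarkeElem (x : EuclideanSpace ℝ (Fin d)) (l : Fin n → ℝ) : EuclideanSpace ℝ (Fin d) :=
  ∑ i ∈ S.Ipos x, S.grad i x + ∑ i ∈ S.Izero x, l i • S.grad i x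

/-- The Clarke quadratic program at `x`: minimise `‖clarkeElem x l‖` over the box `[0,1]ⁿ`. -/
def IsQPSolution (x : EuclideanSpace ℝ (Fin d)) (l : Fin n → ℝ) : Prop :=
  l ∈ Set.Icc (0 : Fin n → ℝ) 1 ∧
    ∀ m ∈ Set.Icc (0 : Fin n → ℝ) 1, ‖S.clarkeElem x l‖ ≤ ‖S.clarkeElem x m‖

theorem exists_isQPSolution (x : EuclideanSpace ℝ (Fin d)) :
    ∃ l : Fin n → ℝ, S.IsQPSolution x l := by
  have hc : Continuous fun l : Fin n → ℝ => ‖S.clarkeElem x l‖ := by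
    unfold clarkeElem
    fun_prop
  obtain ⟨l, hl, hmin⟩ := (isCompact_Icc (a := (0 : Fin n → ℝ)) (b := 1)).exists_isMinOn
    (Set.nonempty_Icc.2 zero_le_one) hc.continuousOn
  exact ⟨l, hl, fun m hm => hmin hm⟩

/-- A solution `α` of the Clarke quadratic program at `x`
(its coordinates in `I⁰(x)` are unique if the spheres are transverse). -/
def alpha (x : EuclideanSpace ℝ (Fin d)) : Fin n → ℝ :=
  (S.exists_isQPSolution x).choose

/-- The generalized gradient: the element of least norm of the Clarke gradient. -/
def genGrad (x : EuclideanSpace ℝ (Fin d)) : EuclideanSpace ℝ (Fin d) :=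
  S.clarkeElem x (S.alpha x)

open Classical in
/-- `I⁺_*(x)`. -/
def IposStar (x : EuclideanSpace ℝ (Fin d)) : Finset (Fin n) :=
  S.Ipos x ∪ (S.Izero x).filter fun i => S.alpha x i = 1

open Classical in
/-- `I⁰_*(x)`. -/
def IzeroStar (x : EuclideanSpace ℝ (Fin d)) : Finset (Fin n) :=
  (S.Izero x).filter fun i => 0 < S.alpha x i ∧ S.alpha x i < 1

open Classical in
/-- `I⁻_*(x)`. -/
def InegStar (x : EuclideanSpace ℝ (Fin d)) : Finset (Fin n) :=
  S.Ineg x ∪ (S.Izero x).filter fun i => S.alpha x i = 0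

/-- The cell that the descent from `x` enters. -/
def cellStar (x : EuclideanSpace ℝ (Fin d)) : Set (EuclideanSpace ℝ (Fin d)) :=
  S.cell (S.IposStar x) (S.IzeroStar x) (S.InegStar x)

/-- The Clarke quadratic program at `x` is non-degenerate: `I⁰_*(x)` is the set of those
`i ∈ I⁰(x)` for which `∇fᵢ(x)` is orthogonal to the generalized gradient. -/
def QPNondegenerate (x : EuclideanSpace ℝ (Fin d)) : Prop :=
  ∀ i ∈ S.Izero x, i ∈ S.IzeroStar x ↔ inner ℝ (S.genGrad x) (S.grad i x) = 0

/-- Line procedure: the first point at which the half-line from `x` towards `p` leaves the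
cell `C`. -/
def lineExit (x p : EuclideanSpace ℝ (Fin d)) (C : Set (EuclideanSpace ℝ (Fin d))) :
    EuclideanSpace ℝ (Fin d) :=
  x + sInf {t : ℝ | 0 < t ∧ x + t • (p - x) ∉ C} • (p - x)

/-- Center and radius `(c_S, R_S)` of the sphere `⋂_{i ∈ J} Sᵢ`: the center is the point of the
affine hull of the centers such that `‖cᵢ - c_S‖² + R_S² = Rᵢ²` for all `i ∈ J`. -/
def interCenterRadius (J : Finset (Fin n)) : EuclideanSpace ℝ (Fin d) × ℝ :=
  Classical.epsilon fun p : EuclideanSpace ℝ (Fin d) × ℝ =>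
    p.1 ∈ affineSpan ℝ (S.center '' (J : Set (Fin n))) ∧ 0 ≤ p.2 ∧
      ∀ i ∈ J, ‖S.center i - p.1‖ ^ 2 + p.2 ^ 2 = S.radiusSq i

/-- The point at which `f_P` restricted to `⋂_{i ∈ J} Sᵢ` reaches its minimum. -/
def minOnInter (P J : Finset (Fin n)) : EuclideanSpace ℝ (Fin d) :=
  Classical.epsilon fun y : EuclideanSpace ℝ (Fin d) =>
    y ∈ S.sphereInter J ∧ ∀ z ∈ S.sphereInter J, S.powerSum P y ≤ S.powerSum P z

/-- The geodesic from `x` to `y` on the sphere of center `c` and radius `R`: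
the radial projection of the segment. -/
def geodesic (c : EuclideanSpace ℝ (Fin d)) (R : ℝ) (x y : EuclideanSpace ℝ (Fin d)) (t : ℝ) :
    EuclideanSpace ℝ (Fin d) :=
  c + (R / ‖(1 - t) • x + t • y - c‖) • ((1 - t) • x + t • y - c)

/-- Sphere procedure: the first point at which the geodesic from `x` to `y` on the sphere of
center `c` and radius `R` leaves the cell `C`. -/
def geodesicExit (c : EuclideanSpace ℝ (Fin d)) (R : ℝ) (x y : EuclideanSpace ℝ (Fin d))
    (C : Set (EuclideanSpace ℝ (Fin d))) : EuclideanSpace ℝ (Fin d) :=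
  geodesic c R x y (sInf {t : ℝ | 0 < t ∧ t ≤ 1 ∧ geodesic c R x y t ∉ C})

open Classical in
/-- One pass through the main loop of the exact algorithm at the current point `x`: the new
current point, and whether the algorithm stops with it. -/
def step (x : EuclideanSpace ℝ (Fin d)) : EuclideanSpace ℝ (Fin d) × Bool :=
  if S.Izero x = ∅ then
    -- `x` lies in a full-dimensional cell
    let C := S.cell (S.Ipos x) (S.Izero x) (S.Ineg x)
    if S.centroid (S.Ipos x) ∈ C then (S.centroid (S.Ipos x), true)
    else (lineExit x (S.centroid (S.Ipos x)) C, false)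
  else if S.genGrad x = 0 then (x, true)
  else if S.IzeroStar x = ∅ then
    if S.centroid (S.IposStar x) ∈ S.cellStar x then (S.centroid (S.IposStar x), true)
    else (lineExit x (S.centroid (S.IposStar x)) (S.cellStar x), false)
  else
    let y := S.minOnInter (S.IposStar x) (S.IzeroStar x)
    if y ∈ S.cellStar x then (y, false)
    else
      let cR := S.interCenterRadius (S.IzeroStar x)
      (geodesicExit cR.1 cR.2 x y (S.cellStar x), false)

/-- State of the exact algorithm started at `x₀` after `N` passes through its main loop: the
current point, and whether the algorithm has stopped. -/
def run (x₀ : EuclideanSpace ℝ (Fin d)) : ℕ → EuclideanSpace ℝ (Fin d) × Bool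
  | 0 => (x₀, false)
  | N + 1 => if (run x₀ N).2 then run x₀ N else S.step (run x₀ N).1

end SphereArrangement

end

/-! Up to the positive factor `1 - η'`, the cost is the sum of the positive parts of the powers.
Transversality forces every point to lie outside some ball (`Ipos_sinkSpheres_nonempty`), so the
generalized gradient is a subgradient with quadratic growth (`cost_add_ge`). Hence the minimizer `p`
is the only point where it vanishes, and small sublevel sets of the cost lie in any given
neighborhood of `p`.

In a small sublevel set each step from a point other than `p` is a move (`exists_isMove`). On the
closure of the cell being entered, the cost is a plain sum of powers; the step follows its negative
projected gradient, so the cost does not increase and the iterates stay in the sublevel set. A move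
either reaches `p` or ends on the boundary of the cell, at a point from which descent enters a
different cell: by non-degeneracy, descending into the same cell would contradict having just left
it.

The heart of the proof is that no cell is entered twice (`IsChart.signsStar_eq_of_cycle`). Given a
cycle of moves, take a point `z` near `p` lying on exactly those spheres, among the ones through
`p`, that the cycle touches. The optimality conditions of all the quadratic programs of the cycle
pass to the limit at `z`. There each program admits the solution of the preceding one as a
competitor, so the least norms decrease; as the cycle closes up they are equal, and transversality
makes all the multipliers equal. Non-degeneracy at `z` then makes all the cells of the cycle equal,
against the fact that consecutive cells differ.

Only `3 ^ c` cells are adjacent to `p`, so `p` is reached. One pass must be saved for the stop at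
`p`, which is a counting argument in `exists_eq_of_isLocalModel`. If `p` lies on no sphere, the cost
is smooth near `p` and one step suffices. -/

namespace SphereArrangement

variable {d n : ℕ} (S : SphereArrangement d n)

/-! ### Signs and weights -/

/-- The cost `∑ᵢ max (0, fᵢ)`. -/
noncomputable def cost (x : EuclideanSpace ℝ (Fin d)) : ℝ := ∑ i, max 0 (S.power i x)

/-- The sign vector of the cell of `x`. -/
noncomputable def signs (x : EuclideanSpace ℝ (Fin d)) (i : Fin n) : SignType :=
  SignType.sign (S.power i x)

open Classical in
/-- The sign vector of the cell that the descent from `x` enters. -/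
noncomputable def signsStar (x : EuclideanSpace ℝ (Fin d)) (i : Fin n) : SignType :=
  if i ∈ S.IposStar x then 1 else if i ∈ S.InegStar x then -1 else 0

open Classical in
/-- The multipliers of all gradients in the generalized gradient. -/
noncomputable def weight (x : EuclideanSpace ℝ (Fin d)) (i : Fin n) : ℝ :=
  if i ∈ S.Ipos x then 1 else if i ∈ S.Izero x then S.alpha x i else 0

/-- The combination `∑ᵢ μᵢ ∇fᵢ(x)`. -/
noncomputable def comb (μ : Fin n → ℝ) (x : EuclideanSpace ℝ (Fin d)) :
    EuclideanSpace ℝ (Fin d) :=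
  ∑ i, μ i • S.grad i x

variable {S}

theorem mem_Ipos {x : EuclideanSpace ℝ (Fin d)} {i : Fin n} :
    i ∈ S.Ipos x ↔ 0 < S.power i x := by
  simp [Ipos]

theorem mem_Izero {x : EuclideanSpace ℝ (Fin d)} {i : Fin n} :
    i ∈ S.Izero x ↔ S.power i x = 0 := by
  simp [Izero]

theorem mem_Ineg {x : EuclideanSpace ℝ (Fin d)} {i : Fin n} :
    i ∈ S.Ineg x ↔ S.power i x < 0 := by
  simp [Ineg]

theorem signs_eq_one {x : EuclideanSpace ℝ (Fin d)} {i : Fin n} :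
    S.signs x i = 1 ↔ 0 < S.power i x := by
  simp [signs, sign_eq_one_iff]

theorem signs_eq_zero {x : EuclideanSpace ℝ (Fin d)} {i : Fin n} :
    S.signs x i = 0 ↔ S.power i x = 0 := by
  simp [signs, sign_eq_zero_iff]

theorem signs_eq_neg_one {x : EuclideanSpace ℝ (Fin d)} {i : Fin n} :
    S.signs x i = -1 ↔ S.power i x < 0 := by
  simp [signs, sign_eq_neg_one_iff]

theorem alpha_mem (x : EuclideanSpace ℝ (Fin d)) (i : Fin n) :
    0 ≤ S.alpha x i ∧ S.alpha x i ≤ 1 := by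
  have h := (S.exists_isQPSolution x).choose_spec.1
  exact ⟨h.1 i, h.2 i⟩

theorem signsStar_eq_one {x : EuclideanSpace ℝ (Fin d)} {i : Fin n} :
    S.signsStar x i = 1 ↔ i ∈ S.IposStar x := by
  unfold signsStar
  split_ifs <;> simp_all

theorem signsStar_of_neg {x : EuclideanSpace ℝ (Fin d)} {i : Fin n} (h : S.power i x < 0) :
    S.signsStar x i = -1 := by
  have h1 : ¬ 0 < S.power i x := by linarith
  have h2 : ¬ S.power i x = 0 := by linarith
  simp [signsStar, IposStar, InegStar, mem_Ipos, mem_Izero, mem_Ineg, h, h1, h2]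

theorem signsStar_of_pos {x : EuclideanSpace ℝ (Fin d)} {i : Fin n} (h : 0 < S.power i x) :
    S.signsStar x i = 1 := by
  simp [signsStar, IposStar, mem_Ipos, h]

theorem signsStar_of_zero {x : EuclideanSpace ℝ (Fin d)} {i : Fin n} (h : S.power i x = 0) :
    S.signsStar x i = if S.alpha x i = 1 then 1 else if S.alpha x i = 0 then -1 else 0 := by
  simp [signsStar, IposStar, InegStar, mem_Ipos, mem_Izero, mem_Ineg, h]

theorem signsStar_eq_neg_one {x : EuclideanSpace ℝ (Fin d)} {i : Fin n} :
    S.signsStar x i = -1 ↔ i ∈ S.InegStar x := by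
  rcases lt_trichotomy (S.power i x) 0 with h | h | h
  · simp [signsStar_of_neg h, InegStar, mem_Ineg, h]
  · rw [signsStar_of_zero h]
    simp only [InegStar, Finset.mem_union, mem_Ineg, h, lt_irrefl, false_or, Finset.mem_filter,
      mem_Izero, true_and]
    split_ifs <;> simp_all
  · have h1 : ¬ S.power i x < 0 := by linarith
    simp [signsStar_of_pos h, InegStar, mem_Ineg, mem_Izero, h.ne', h1]

theorem signsStar_eq_zero {x : EuclideanSpace ℝ (Fin d)} {i : Fin n} :
    S.signsStar x i = 0 ↔ i ∈ S.IzeroStar x := by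
  rcases lt_trichotomy (S.power i x) 0 with h | h | h
  · simp [signsStar_of_neg h, IzeroStar, mem_Izero, h.ne]
  · rw [signsStar_of_zero h]
    have := alpha_mem (S := S) x i
    simp only [IzeroStar, Finset.mem_filter, mem_Izero, h, true_and]
    split_ifs with h1 h2
    · simp [h1]
    · simp [h2]
    · simp only [true_iff]
      exact ⟨lt_of_le_of_ne this.1 (Ne.symm h2), lt_of_le_of_ne this.2 h1⟩
  · simp [signsStar_of_pos h, IzeroStar, mem_Izero, h.ne']

theorem signsStar_eq_signs {x : EuclideanSpace ℝ (Fin d)} {i : Fin n} (h : S.signs x i ≠ 0) :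
    S.signsStar x i = S.signs x i := by
  rw [Ne, signs_eq_zero] at h
  rcases lt_or_gt_of_ne h with h | h
  · rw [signsStar_of_neg h, signs_eq_neg_one.2 h]
  · rw [signsStar_of_pos h, signs_eq_one.2 h]

theorem signType_cases (s : SignType) : s = 1 ∨ s = 0 ∨ s = -1 := by
  cases s <;> simp [SignType.zero_eq_zero, SignType.pos_eq_one, SignType.neg_eq_neg_one]

theorem mem_cell_iff {P Z N : Finset (Fin n)} {t : Fin n → SignType}
    (hP : ∀ i, t i = 1 ↔ i ∈ P) (hZ : ∀ i, t i = 0 ↔ i ∈ Z) (hN : ∀ i, t i = -1 ↔ i ∈ N)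
    {z : EuclideanSpace ℝ (Fin d)} : z ∈ S.cell P Z N ↔ S.signs z = t := by
  constructor
  · rintro ⟨h1, h2, h3⟩
    funext i
    rcases signType_cases (t i) with h | h | h
    · rw [h, signs_eq_one, ← mem_Ipos, h1, ← hP, h]
    · rw [h, signs_eq_zero, ← mem_Izero, h2, ← hZ, h]
    · rw [h, signs_eq_neg_one, ← mem_Ineg, h3, ← hN, h]
  · rintro rfl
    refine ⟨?_, ?_, ?_⟩ <;> ext i
    · rw [← hP, mem_Ipos, signs_eq_one]
    · rw [← hZ, mem_Izero, signs_eq_zero]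
    · rw [← hN, mem_Ineg, signs_eq_neg_one]

theorem mem_cellStar {x z : EuclideanSpace ℝ (Fin d)} :
    z ∈ S.cellStar x ↔ S.signs z = S.signsStar x :=
  mem_cell_iff (fun _ => signsStar_eq_one) (fun _ => signsStar_eq_zero)
    (fun _ => signsStar_eq_neg_one)

theorem cell_eq_cellStar {x : EuclideanSpace ℝ (Fin d)} (h : S.Izero x = ∅) :
    S.cell (S.Ipos x) (S.Izero x) (S.Ineg x) = S.cellStar x := by
  simp [cellStar, IposStar, IzeroStar, InegStar, h]

theorem weight_of_pos {x : EuclideanSpace ℝ (Fin d)} {i : Fin n} (h : 0 < S.power i x) :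
    S.weight x i = 1 := by
  simp [weight, mem_Ipos, h]

theorem weight_of_neg {x : EuclideanSpace ℝ (Fin d)} {i : Fin n} (h : S.power i x < 0) :
    S.weight x i = 0 := by
  simp [weight, mem_Ipos, mem_Izero, h.ne, h.not_gt]

theorem weight_of_zero {x : EuclideanSpace ℝ (Fin d)} {i : Fin n} (h : S.power i x = 0) :
    S.weight x i = S.alpha x i := by
  simp [weight, mem_Ipos, mem_Izero, h]

theorem weight_mem (x : EuclideanSpace ℝ (Fin d)) (i : Fin n) :
    0 ≤ S.weight x i ∧ S.weight x i ≤ 1 := by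
  have := alpha_mem (S := S) x i
  unfold weight
  split_ifs <;> simp [this]

theorem weight_eq_one {x : EuclideanSpace ℝ (Fin d)} {i : Fin n} :
    S.weight x i = 1 ↔ S.signsStar x i = 1 := by
  rcases lt_trichotomy (S.power i x) 0 with h | h | h
  · simp [signsStar_of_neg h, weight_of_neg h]
  · rw [signsStar_of_zero h, weight_of_zero h]
    split_ifs <;> simp_all
  · simp [signsStar_of_pos h, weight_of_pos h]

theorem weight_eq_zero {x : EuclideanSpace ℝ (Fin d)} {i : Fin n} :
    S.weight x i = 0 ↔ S.signsStar x i = -1 := by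
  rcases lt_trichotomy (S.power i x) 0 with h | h | h
  · simp [signsStar_of_neg h, weight_of_neg h]
  · rw [signsStar_of_zero h, weight_of_zero h]
    split_ifs <;> simp_all
  · simp [signsStar_of_pos h, weight_of_pos h]

theorem clarkeElem_eq (x : EuclideanSpace ℝ (Fin d)) (l : Fin n → ℝ) :
    S.clarkeElem x l =
      ∑ i, (if i ∈ S.Ipos x then 1 else if i ∈ S.Izero x then l i else 0) • S.grad i x := by
  classical
  have : ∀ i, (if i ∈ S.Ipos x then (1 : ℝ) else if i ∈ S.Izero x then l i else 0) • S.grad i x =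
      (if i ∈ S.Ipos x then S.grad i x else 0) +
        (if i ∈ S.Izero x then l i • S.grad i x else 0) := by
    intro i
    by_cases h1 : i ∈ S.Ipos x
    · have : i ∉ S.Izero x := by
        rw [mem_Ipos] at h1
        rw [mem_Izero]
        exact h1.ne'
      simp [h1, this]
    · by_cases h2 : i ∈ S.Izero x <;> simp [h1, h2]
  simp_rw [this]
  simp [clarkeElem, Finset.sum_add_distrib]

theorem genGrad_eq_comb (x : EuclideanSpace ℝ (Fin d)) :
    S.genGrad x = S.comb (S.weight x) x := by
  classical
  rw [genGrad, clarkeElem_eq, comb]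
  refine Finset.sum_congr rfl fun i _ => ?_
  simp only [weight, alpha]

/-! ### Powers and gradients -/

theorem power_add (i : Fin n) (x u : EuclideanSpace ℝ (Fin d)) :
    S.power i (x + u) = S.power i x + inner ℝ (S.grad i x) u + ‖u‖ ^ 2 := by
  have : x + u - S.center i = (x - S.center i) + u := by abel
  rw [power, this, norm_add_sq_real, power, grad, real_inner_smul_left]
  ring

theorem continuous_power (i : Fin n) : Continuous (S.power i) := by
  unfold power
  fun_prop

theorem continuous_grad (i : Fin n) : Continuous (S.grad i) := by
  unfold grad
  fun_prop

theorem continuous_cost : Continuous S.cost := by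
  unfold cost
  have := fun i => continuous_power (S := S) i
  fun_prop

theorem hasDerivAt_power {γ : ℝ → EuclideanSpace ℝ (Fin d)} {γ' : EuclideanSpace ℝ (Fin d)}
    {t : ℝ} (h : HasDerivAt γ γ' t) (i : Fin n) :
    HasDerivAt (fun s => S.power i (γ s)) (inner ℝ (S.grad i (γ t)) γ') t := by
  have h1 := ((h.sub_const (S.center i)).norm_sq).sub_const (S.radiusSq i)
  rw [grad, real_inner_smul_left]
  exact h1

/-! ### Optimality conditions -/

/-- First-order optimality conditions of a quadratic program with sign vector `s` at `x`,
in closed form; `t` prescribes which box constraints are allowed to be active. -/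
structure IsKKT (S : SphereArrangement d n) (x : EuclideanSpace ℝ (Fin d))
    (s t : Fin n → SignType) (μ : Fin n → ℝ) : Prop where
  mem : ∀ i, 0 ≤ μ i ∧ μ i ≤ 1
  one : ∀ i, t i = 1 → μ i = 1
  zero : ∀ i, t i = -1 → μ i = 0
  inner_eq : ∀ i, s i = 0 → t i = 0 → inner ℝ (S.comb μ x) (S.grad i x) = 0
  inner_nonpos : ∀ i, s i = 0 → t i = 1 → inner ℝ (S.comb μ x) (S.grad i x) ≤ 0
  inner_nonneg : ∀ i, s i = 0 → t i = -1 → 0 ≤ inner ℝ (S.comb μ x) (S.grad i x)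

/-- Expand the square, divide by `a` and let `a` tend to zero: a one-sided first-order condition.
Applied to one multiplier at a time, it yields all the optimality conditions of the quadratic
program. -/
theorem inner_nonneg_of_norm_le {E : Type*} [NormedAddCommGroup E] [InnerProductSpace ℝ E]
    {v g : E} {ε : ℝ} (hε : 0 < ε) (h : ∀ a, 0 < a → a ≤ ε → ‖v‖ ≤ ‖v + a • g‖) :
    0 ≤ inner ℝ v g := by
  by_contra hneg
  push Not at hneg
  set q := inner ℝ v g with hq
  have key : ∀ a, 0 < a → a ≤ ε → 0 ≤ 2 * q + a * ‖g‖ ^ 2 := by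
    intro a ha hle
    have h1 := pow_le_pow_left₀ (norm_nonneg v) (h a ha hle) 2
    rw [norm_add_sq_real, real_inner_smul_right, norm_smul, Real.norm_eq_abs, mul_pow,
      sq_abs] at h1
    have h2 : 0 ≤ a * (2 * q + a * ‖g‖ ^ 2) := by rw [hq]; nlinarith
    exact nonneg_of_mul_nonneg_right h2 ha
  have hlim : Tendsto (fun a : ℝ => 2 * q + a * ‖g‖ ^ 2) (𝓝[>] 0) (𝓝 (2 * q + 0 * ‖g‖ ^ 2)) := by
    apply Tendsto.mono_left _ nhdsWithin_le_nhds
    apply Continuous.tendsto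
    fun_prop
  have := ge_of_tendsto hlim (by
    filter_upwards [Ioc_mem_nhdsGT hε] with a ha
    exact key a ha.1 ha.2)
  linarith

theorem genGrad_update (x : EuclideanSpace ℝ (Fin d)) {i : Fin n} (hi : S.power i x = 0) {b : ℝ}
    (hb0 : 0 ≤ b) (hb1 : b ≤ 1) :
    ‖S.genGrad x‖ ≤ ‖S.genGrad x + (b - S.alpha x i) • S.grad i x‖ := by
  classical
  have hsol := (S.exists_isQPSolution x).choose_spec
  have h := hsol.2 (Function.update (S.alpha x) i b) (by
    constructor <;> intro j <;> by_cases hj : j = i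
    · subst hj; simpa using hb0
    · simpa [hj] using (alpha_mem x j).1
    · subst hj; simpa using hb1
    · simpa [hj] using (alpha_mem x j).2)
  refine h.trans (le_of_eq (congrArg norm ?_))
  rw [genGrad, clarkeElem, clarkeElem, add_assoc]
  congr 1
  have hi' : i ∈ S.Izero x := mem_Izero.2 hi
  rw [← Finset.add_sum_erase _ _ hi', ← Finset.add_sum_erase _ _ hi']
  rw [Finset.sum_congr rfl (g := fun j => S.alpha x j • S.grad j x)
    (s₂ := (S.Izero x).erase i) (fun j hj => by
      rw [Function.update_of_ne (Finset.ne_of_mem_erase hj)]), Function.update_self, sub_smul]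
  abel

theorem inner_genGrad_nonneg {x : EuclideanSpace ℝ (Fin d)} {i : Fin n} (hi : S.power i x = 0)
    (h : S.alpha x i < 1) : 0 ≤ inner ℝ (S.genGrad x) (S.grad i x) := by
  refine inner_nonneg_of_norm_le (sub_pos.2 h) fun a ha hle => ?_
  have := genGrad_update x hi (b := S.alpha x i + a) (by linarith [(alpha_mem (S := S) x i).1])
    (by linarith)
  simpa using this

theorem inner_genGrad_nonpos {x : EuclideanSpace ℝ (Fin d)} {i : Fin n} (hi : S.power i x = 0)
    (h : 0 < S.alpha x i) : inner ℝ (S.genGrad x) (S.grad i x) ≤ 0 := by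
  have : 0 ≤ inner ℝ (S.genGrad x) (-S.grad i x) := by
    refine inner_nonneg_of_norm_le h fun a ha hle => ?_
    have := genGrad_update x hi (b := S.alpha x i - a) (by linarith)
      (by linarith [(alpha_mem (S := S) x i).2])
    simpa using this
  rw [inner_neg_right] at this
  linarith

theorem isKKT_weight (x : EuclideanSpace ℝ (Fin d)) :
    S.IsKKT x (S.signs x) (S.signsStar x) (S.weight x) where
  mem := weight_mem x
  one i h := weight_eq_one.2 h
  zero i h := weight_eq_zero.2 h
  inner_eq i hs h := by
    rw [← genGrad_eq_comb]
    rw [signs_eq_zero] at hs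
    rw [signsStar_eq_zero, IzeroStar, Finset.mem_filter] at h
    exact le_antisymm (inner_genGrad_nonpos hs h.2.1) (inner_genGrad_nonneg hs h.2.2)
  inner_nonpos i hs h := by
    rw [← genGrad_eq_comb]
    rw [signs_eq_zero] at hs
    rw [← weight_eq_one, weight_of_zero hs] at h
    exact inner_genGrad_nonpos hs (by linarith)
  inner_nonneg i hs h := by
    rw [← genGrad_eq_comb]
    rw [signs_eq_zero] at hs
    rw [← weight_eq_zero, weight_of_zero hs] at h
    exact inner_genGrad_nonneg hs (by linarith)

/-- Variational inequality for a solution of the optimality conditions. -/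
theorem IsKKT.inner_sub_nonneg {x : EuclideanSpace ℝ (Fin d)} {s t : Fin n → SignType}
    {μ ν : Fin n → ℝ} (h : S.IsKKT x s t μ) (hν : ∀ i, 0 ≤ ν i ∧ ν i ≤ 1)
    (heq : ∀ i, s i ≠ 0 → ν i = μ i) :
    0 ≤ inner ℝ (S.comb μ x) (S.comb ν x - S.comb μ x) := by
  have : S.comb ν x - S.comb μ x = ∑ i, (ν i - μ i) • S.grad i x := by
    simp [comb, sub_smul]
  rw [this, inner_sum]
  refine Finset.sum_nonneg fun i _ => ?_
  rw [real_inner_smul_right]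
  by_cases hs : s i = 0
  · rcases signType_cases (t i) with ht | ht | ht
    · have h1 := h.one i ht
      have h2 := h.inner_nonpos i hs ht
      have h3 := (hν i).2
      exact mul_nonneg_of_nonpos_of_nonpos (by linarith) h2
    · rw [h.inner_eq i hs ht, mul_zero]
    · have h1 := h.zero i ht
      have h2 := h.inner_nonneg i hs ht
      have h3 := (hν i).1
      exact mul_nonneg (by linarith) h2
  · rw [heq i hs, sub_self, zero_mul]

theorem eq_of_comb_eq (hT : S.Transverse) {x : EuclideanSpace ℝ (Fin d)} {μ ν : Fin n → ℝ}
    (h : S.comb μ x = S.comb ν x) (hne : ∀ i, S.signs x i ≠ 0 → μ i = ν i) : μ = ν := by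
  classical
  have hl := hT x
  rw [Fintype.linearIndependent_iff] at hl
  have hsum : ∑ i : {i : Fin n // S.power i x = 0}, (μ i - ν i) • S.grad i x = 0 := by
    have h0 : ∑ i, (μ i - ν i) • S.grad i x = 0 := by
      simp only [sub_smul, Finset.sum_sub_distrib]
      exact sub_eq_zero.2 h
    rw [← h0, ← Finset.sum_subtype (Finset.univ.filter fun i => S.power i x = 0) (by simp)
      (fun i => (μ i - ν i) • S.grad i x)]
    refine Finset.sum_filter_of_ne fun i _ hi => ?_
    by_contra hp
    apply hi
    rw [hne i (by rwa [Ne, signs_eq_zero]), sub_self, zero_smul]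
  funext i
  by_cases hi : S.power i x = 0
  · have := hl (fun i => μ i - ν i) hsum ⟨i, hi⟩
    linarith
  · exact hne i (by rwa [Ne, signs_eq_zero])

/-- Each solution is a competitor in the variational inequality of the other; adding the two
inequalities makes the combinations equal, and linear independence of the active gradients then
makes the multipliers equal. -/
theorem IsKKT.unique (hT : S.Transverse) {x : EuclideanSpace ℝ (Fin d)}
    {t t' : Fin n → SignType} {μ ν : Fin n → ℝ} (hμ : S.IsKKT x (S.signs x) t μ)
    (hν : S.IsKKT x (S.signs x) t' ν) (heq : ∀ i, S.signs x i ≠ 0 → μ i = ν i) : μ = ν := by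
  refine eq_of_comb_eq hT ?_ heq
  have h1 := hμ.inner_sub_nonneg hν.mem (fun i hi => (heq i hi).symm)
  have h2 := hν.inner_sub_nonneg hμ.mem heq
  have h3 : ‖S.comb ν x - S.comb μ x‖ ^ 2 ≤ 0 := by
    rw [← real_inner_self_eq_norm_sq, inner_sub_left]
    rw [← neg_sub, inner_neg_right] at h2
    linarith
  have h4 : ‖S.comb ν x - S.comb μ x‖ = 0 := by nlinarith [norm_nonneg (S.comb ν x - S.comb μ x)]
  exact (sub_eq_zero.1 (norm_eq_zero.1 h4)).symm

/-- For fixed `s` and `t` the conditions are closed in the pair of point and multipliers, and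
projecting along the compact cube preserves closedness. This is why `s` is kept separate from the
signs at the point: the conditions survive limits at which more powers vanish. -/
theorem isClosed_setOf_isKKT (s t : Fin n → SignType) :
    IsClosed {x | ∃ μ, S.IsKKT x s t μ} := by
  have hcl : IsClosed {p : EuclideanSpace ℝ (Fin d) × Set.Icc (0 : Fin n → ℝ) 1 |
      S.IsKKT p.1 s t p.2} := by
    have hg := fun i => continuous_grad (S := S) i
    have hm : ∀ i, Continuous fun p : EuclideanSpace ℝ (Fin d) × Set.Icc (0 : Fin n → ℝ) 1 =>
        p.2.1 i := fun i => (continuous_apply i).comp (continuous_subtype_val.comp continuous_snd)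
    have hc : Continuous fun p : EuclideanSpace ℝ (Fin d) × Set.Icc (0 : Fin n → ℝ) 1 =>
        S.comb p.2 p.1 :=
      continuous_finsetSum _ fun i _ => (hm i).smul ((hg i).comp continuous_fst)
    have : {p : EuclideanSpace ℝ (Fin d) × Set.Icc (0 : Fin n → ℝ) 1 | S.IsKKT p.1 s t p.2} =
        {p | (∀ i, t i = 1 → p.2.1 i = 1) ∧ (∀ i, t i = -1 → p.2.1 i = 0) ∧
          (∀ i, s i = 0 → t i = 0 → inner ℝ (S.comb p.2 p.1) (S.grad i p.1) = 0) ∧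
          (∀ i, s i = 0 → t i = 1 → inner ℝ (S.comb p.2 p.1) (S.grad i p.1) ≤ 0) ∧
          (∀ i, s i = 0 → t i = -1 → 0 ≤ inner ℝ (S.comb p.2 p.1) (S.grad i p.1))} := by
      ext p
      exact ⟨fun h => ⟨h.one, h.zero, h.inner_eq, h.inner_nonpos, h.inner_nonneg⟩,
        fun h => ⟨fun i => ⟨p.2.2.1 i, p.2.2.2 i⟩, h.1, h.2.1, h.2.2.1, h.2.2.2.1, h.2.2.2.2⟩⟩
    rw [this]
    simp only [Set.ofPred_and, Set.ofPred_forall]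
    refine IsClosed.inter ?_ (IsClosed.inter ?_ (IsClosed.inter ?_ (IsClosed.inter ?_ ?_))) <;>
      refine isClosed_iInter fun i => isClosed_iInter fun h => ?_
    · exact isClosed_eq (hm i) continuous_const
    · exact isClosed_eq (hm i) continuous_const
    · exact isClosed_iInter fun h => isClosed_eq (by fun_prop) (by fun_prop)
    · exact isClosed_iInter fun h => isClosed_le (by fun_prop) (by fun_prop)
    · exact isClosed_iInter fun h => isClosed_le (by fun_prop) (by fun_prop)
  have : CompactSpace (Set.Icc (0 : Fin n → ℝ) 1) := isCompact_iff_compactSpace.1 isCompact_Icc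
  have h2 := isClosedMap_fst_of_compactSpace (X := EuclideanSpace ℝ (Fin d))
    (Y := Set.Icc (0 : Fin n → ℝ) 1) _ hcl
  convert h2 using 1
  ext x
  constructor
  · rintro ⟨μ, hμ⟩
    exact ⟨(x, ⟨μ, fun i => (hμ.mem i).1, fun i => (hμ.mem i).2⟩), hμ, rfl⟩
  · rintro ⟨⟨y, μ⟩, hμ, rfl⟩
    exact ⟨μ, hμ⟩

theorem QPNondegenerate.signsStar_eq_zero {x : EuclideanSpace ℝ (Fin d)}
    (h : S.QPNondegenerate x) {i : Fin n} (hi : S.signs x i = 0) :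
    S.signsStar x i = 0 ↔ inner ℝ (S.genGrad x) (S.grad i x) = 0 := by
  rw [SphereArrangement.signsStar_eq_zero]
  exact h i (mem_Izero.2 (signs_eq_zero.1 hi))

theorem IsKKT.weight_eq_of_signs_ne_zero {x : EuclideanSpace ℝ (Fin d)}
    {t : Fin n → SignType} {μ : Fin n → ℝ} (hμ : S.IsKKT x (S.signs x) t μ)
    (ht : ∀ i, S.signs x i ≠ 0 → t i = S.signs x i) {i : Fin n} (hi : S.signs x i ≠ 0) :
    μ i = S.weight x i := by
  rcases signType_cases (S.signs x i) with h | h | h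
  · rw [hμ.one i (by rw [ht i hi, h]), weight_of_pos (signs_eq_one.1 h)]
  · exact absurd h hi
  · rw [hμ.zero i (by rw [ht i hi, h]), weight_of_neg (signs_eq_neg_one.1 h)]

/-- By uniqueness `μ` is `weight x`. The only ambiguity left is an index with `t i = 0` whose
multiplier is 0 or 1 while the inner product vanishes, and non-degeneracy excludes it. -/
theorem signsStar_eq_of_isKKT (hT : S.Transverse) {x : EuclideanSpace ℝ (Fin d)}
    (hx : S.QPNondegenerate x) {t : Fin n → SignType} {μ : Fin n → ℝ}
    (hμ : S.IsKKT x (S.signs x) t μ) (ht : ∀ i, S.signs x i ≠ 0 → t i = S.signs x i) :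
    S.signsStar x = t := by
  have heq : μ = S.weight x :=
    hμ.unique hT (isKKT_weight x) (fun i hi => hμ.weight_eq_of_signs_ne_zero ht hi)
  subst heq
  funext i
  by_cases hi : S.signs x i = 0
  · rcases signType_cases (t i) with h | h | h
    · rw [h, ← weight_eq_one, hμ.one i h]
    · rw [h, hx.signsStar_eq_zero hi, genGrad_eq_comb, hμ.inner_eq i hi h]
    · rw [h, ← weight_eq_zero, hμ.zero i h]
  · rw [signsStar_eq_signs hi, ht i hi]

/-- The cell entered by the descent is constant on preconnected parts of a cell on which the
quadratic program is non-degenerate. -/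
theorem signsStar_const (hT : S.Transverse) {A : Set (EuclideanSpace ℝ (Fin d))}
    (hA : IsPreconnected A) {s : Fin n → SignType} (hs : ∀ x ∈ A, S.signs x = s)
    (hnd : ∀ x ∈ A, S.QPNondegenerate x) {x y : EuclideanSpace ℝ (Fin d)} (hx : x ∈ A)
    (hy : y ∈ A) : S.signsStar y = S.signsStar x := by
  by_contra hne
  rw [isPreconnected_closed_iff] at hA
  -- The set `A` is covered by the closed set of points solved with the pattern of `x` and by the
  -- finite union of those solved with another pattern. Connectedness gives a point in both, where
  -- non-degeneracy allows only one pattern.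
  let T : Set (Fin n → SignType) := {t | t ≠ S.signsStar x ∧ ∀ i, s i ≠ 0 → t i = s i}
  obtain ⟨z, hz, ⟨μ, hμ⟩, hz2⟩ := hA {z | ∃ μ, S.IsKKT z s (S.signsStar x) μ}
    (⋃ t ∈ T, {z | ∃ μ, S.IsKKT z s t μ}) (isClosed_setOf_isKKT _ _)
    ((Set.toFinite T).isClosed_biUnion fun t _ => isClosed_setOf_isKKT _ _)
    (by
      intro z hz
      by_cases h : S.signsStar z = S.signsStar x
      · left
        exact ⟨_, by rw [← h, ← hs z hz]; exact isKKT_weight z⟩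
      · right
        refine Set.mem_biUnion (x := S.signsStar z) ⟨h, fun i hi => ?_⟩
          ⟨_, by rw [← hs z hz]; exact isKKT_weight z⟩
        rw [← hs z hz] at hi ⊢
        exact signsStar_eq_signs hi)
    ⟨x, hx, _, by rw [← hs x hx]; exact isKKT_weight x⟩
    ⟨y, hy, Set.mem_biUnion (x := S.signsStar y) ⟨hne, fun i hi => by
        rw [← hs y hy] at hi ⊢
        exact signsStar_eq_signs hi⟩ ⟨_, by rw [← hs y hy]; exact isKKT_weight y⟩⟩
  obtain ⟨t, ht, ν, hν⟩ := Set.mem_iUnion₂.1 hz2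
  rw [← hs z hz] at hμ hν
  have h1 := signsStar_eq_of_isKKT hT (hnd z hz) hμ (fun i hi => by
    rw [hs z hz, ← hs x hx] at hi ⊢
    exact signsStar_eq_signs hi)
  have h2 := signsStar_eq_of_isKKT hT (hnd z hz) hν (fun i hi => by
    rw [hs z hz] at hi ⊢
    exact ht.2 i hi)
  exact ht.1 (h2.symm.trans h1)

/-! ### Minimizers of the cost -/

/-- `z` lies in the closure of the cell with sign vector `t`. -/
def IsFace (s t : Fin n → SignType) : Prop := ∀ i, s i = t i ∨ s i = 0

theorem isFace_signs_signsStar (x : EuclideanSpace ℝ (Fin d)) :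
    IsFace (S.signs x) (S.signsStar x) := by
  intro i
  by_cases h : S.signs x i = 0
  · exact Or.inr h
  · exact Or.inl (signsStar_eq_signs h).symm

theorem cost_eq_powerSum {x z : EuclideanSpace ℝ (Fin d)}
    (h : IsFace (S.signs z) (S.signsStar x)) : S.cost z = S.powerSum (S.IposStar x) z := by
  classical
  have : ∀ i, max 0 (S.power i z) = if i ∈ S.IposStar x then S.power i z else 0 := by
    intro i
    by_cases hi : i ∈ S.IposStar x
    · rw [if_pos hi]
      rw [← signsStar_eq_one] at hi
      apply max_eq_right
      rcases h i with h | h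
      · exact (signs_eq_one.1 (h.trans hi)).le
      · exact (signs_eq_zero.1 h).ge
    · rw [if_neg hi]
      rw [← signsStar_eq_one] at hi
      apply max_eq_left
      by_contra hp
      push Not at hp
      have h1 := signs_eq_one.2 hp
      rcases h i with h | h
      · exact hi (h ▸ h1)
      · rw [h] at h1
        exact absurd h1 (by decide)
  simp only [cost, powerSum, this]
  simp

theorem weight_mul_power (x : EuclideanSpace ℝ (Fin d)) (i : Fin n) :
    S.weight x i * S.power i x = max 0 (S.power i x) := by
  rcases lt_trichotomy (S.power i x) 0 with h | h | h
  · rw [weight_of_neg h, max_eq_left h.le, zero_mul]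
  · simp [h]
  · rw [weight_of_pos h, max_eq_right h.le, one_mul]

theorem one_le_sum_weight {x : EuclideanSpace ℝ (Fin d)} (h : (S.Ipos x).Nonempty) :
    1 ≤ ∑ i, S.weight x i := by
  obtain ⟨i, hi⟩ := h
  rw [mem_Ipos] at hi
  calc (1 : ℝ) = S.weight x i := (weight_of_pos hi).symm
    _ ≤ _ := Finset.single_le_sum (fun j _ => (weight_mem x j).1) (Finset.mem_univ i)

/-- A weight in `[0,1]` times a power is at most the positive part of the power, with equality at
`x`. Summing the exact expansions of the powers gives the linear term, and the weights add up to at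
least 1 because some ball does not contain `x`. -/
theorem cost_add_ge {x : EuclideanSpace ℝ (Fin d)} (h : (S.Ipos x).Nonempty)
    (u : EuclideanSpace ℝ (Fin d)) :
    S.cost x + inner ℝ (S.genGrad x) u + ‖u‖ ^ 2 ≤ S.cost (x + u) := by
  have h1 : ∀ i, max 0 (S.power i x) + S.weight x i * inner ℝ (S.grad i x) u +
      S.weight x i * ‖u‖ ^ 2 ≤ max 0 (S.power i (x + u)) := by
    intro i
    rw [← weight_mul_power, ← mul_add, ← mul_add, ← power_add]
    have := weight_mem (S := S) x i
    rcases le_total 0 (S.power i (x + u)) with h | h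
    · exact (mul_le_of_le_one_left h this.2).trans (le_max_right _ _)
    · exact (mul_nonpos_of_nonneg_of_nonpos this.1 h).trans (le_max_left _ _)
  have h2 := Finset.sum_le_sum fun i (_ : i ∈ Finset.univ) => h1 i
  simp only [Finset.sum_add_distrib, ← Finset.sum_mul] at h2
  have h3 : inner ℝ (S.genGrad x) u = ∑ i, S.weight x i * inner ℝ (S.grad i x) u := by
    rw [genGrad_eq_comb, comb, sum_inner]
    simp only [real_inner_smul_left]
  have h4 := mul_le_mul_of_nonneg_right (one_le_sum_weight h) (sq_nonneg ‖u‖)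
  rw [h3]
  unfold cost
  linarith

theorem cost_ge_of_genGrad_eq_zero {x : EuclideanSpace ℝ (Fin d)} (h : (S.Ipos x).Nonempty)
    (h0 : S.genGrad x = 0) (z : EuclideanSpace ℝ (Fin d)) :
    S.cost x + ‖z - x‖ ^ 2 ≤ S.cost z := by
  have := cost_add_ge h (z - x)
  rwa [h0, inner_zero_left, add_zero, add_sub_cancel] at this

theorem eq_of_cost_le {x z : EuclideanSpace ℝ (Fin d)} (h : (S.Ipos x).Nonempty)
    (h0 : S.genGrad x = 0) (hz : S.cost z ≤ S.cost x) : z = x := by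
  have := cost_ge_of_genGrad_eq_zero h h0 z
  have h1 : ‖z - x‖ = 0 := by nlinarith [norm_nonneg (z - x)]
  exact sub_eq_zero.1 (norm_eq_zero.1 h1)

/-- For a vanishing power, complementarity decides the first-order change of the positive part: `α =
0` means the power does not grow to first order, `α = 1` that it does not decrease, and an
intermediate `α` that the linear term is zero. -/
theorem eventually_max_power_le (x : EuclideanSpace ℝ (Fin d)) (i : Fin n) :
    ∀ᶠ h : ℝ in 𝓝[>] 0, max 0 (S.power i (x + (-h) • S.genGrad x)) ≤
      max 0 (S.power i x) - h * (S.weight x i * inner ℝ (S.genGrad x) (S.grad i x)) +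
        h ^ 2 * ‖S.genGrad x‖ ^ 2 := by
  have hc : ContinuousAt (fun h : ℝ => S.power i (x + (-h) • S.genGrad x)) 0 := by
    have := continuous_power (S := S) i
    fun_prop
  have hexp : ∀ h : ℝ, S.power i (x + (-h) • S.genGrad x) = S.power i x -
      h * inner ℝ (S.genGrad x) (S.grad i x) + h ^ 2 * ‖S.genGrad x‖ ^ 2 := by
    intro h
    rw [power_add, real_inner_smul_right, norm_smul, real_inner_comm, Real.norm_eq_abs, mul_pow,
      sq_abs]
    ring
  rcases lt_trichotomy (S.power i x) 0 with hi | hi | hi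
  · have : ∀ᶠ h : ℝ in 𝓝 0, S.power i (x + (-h) • S.genGrad x) < 0 :=
      hc.eventually_lt continuousAt_const (by simpa using hi)
    filter_upwards [this.filter_mono nhdsWithin_le_nhds] with h hh
    rw [max_eq_left hh.le, max_eq_left hi.le, weight_of_neg hi]
    have : 0 ≤ h ^ 2 * ‖S.genGrad x‖ ^ 2 := by positivity
    linarith
  · filter_upwards [self_mem_nhdsWithin] with h hh
    have hh : 0 < h := hh
    rw [hexp, hi, max_self, weight_of_zero hi]
    have h0 := alpha_mem (S := S) x i
    have hq : 0 ≤ h ^ 2 * ‖S.genGrad x‖ ^ 2 := by positivity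
    set q := inner ℝ (S.genGrad x) (S.grad i x) with hqdef
    rcases eq_or_lt_of_le h0.1 with h1 | h1
    · have h2 : 0 ≤ q := inner_genGrad_nonneg hi (by linarith)
      rw [← h1]
      apply max_le
      · nlinarith
      · nlinarith [mul_nonneg hh.le h2]
    · rcases eq_or_lt_of_le h0.2 with h3 | h3
      · have h2 : q ≤ 0 := inner_genGrad_nonpos hi (by linarith)
        rw [h3]
        apply max_le
        · nlinarith [mul_nonneg hh.le (neg_nonneg.2 h2)]
        · nlinarith
      · have h2 : q = 0 :=
          le_antisymm (inner_genGrad_nonpos hi h1) (inner_genGrad_nonneg hi h3)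
        rw [h2]
        apply max_le <;> linarith
  · have : ∀ᶠ h : ℝ in 𝓝 0, 0 < S.power i (x + (-h) • S.genGrad x) :=
      continuousAt_const.eventually_lt hc (by simpa using hi)
    filter_upwards [this.filter_mono nhdsWithin_le_nhds] with h hh
    rw [max_eq_right hh.le, max_eq_right hi.le, weight_of_pos hi, hexp]
    linarith

theorem genGrad_eq_zero_of_isMin {x : EuclideanSpace ℝ (Fin d)} (h : ∀ y, S.cost x ≤ S.cost y) :
    S.genGrad x = 0 := by
  by_contra hne
  have hpos : 0 < ‖S.genGrad x‖ ^ 2 := by positivity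
  have h1 : ∀ᶠ t : ℝ in 𝓝[>] 0, ∀ i, max 0 (S.power i (x + (-t) • S.genGrad x)) ≤
      max 0 (S.power i x) - t * (S.weight x i * inner ℝ (S.genGrad x) (S.grad i x)) +
        t ^ 2 * ‖S.genGrad x‖ ^ 2 :=
    eventually_all.2 fun i => eventually_max_power_le x i
  -- The linear gain is `t ‖g‖²` and the total quadratic error is at most `n t² ‖g‖²`, so this makes
  -- the cost drop strictly.
  have h2 : ∀ᶠ t : ℝ in 𝓝[>] 0, (n : ℝ) * t < 1 := by
    apply Filter.Eventually.filter_mono nhdsWithin_le_nhds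
    exact ContinuousAt.eventually_lt (by fun_prop) continuousAt_const (by simp)
  obtain ⟨t, ht1, ht2, ht⟩ := (h1.and (h2.and self_mem_nhdsWithin)).exists
  have ht : 0 < t := ht
  have h3 := Finset.sum_le_sum fun i (_ : i ∈ Finset.univ) => ht1 i
  simp only [Finset.sum_add_distrib, Finset.sum_sub_distrib, ← Finset.mul_sum,
    Finset.sum_const, Finset.card_univ, Fintype.card_fin, nsmul_eq_mul] at h3
  have h4 : ∑ i, S.weight x i * inner ℝ (S.genGrad x) (S.grad i x) = ‖S.genGrad x‖ ^ 2 := by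
    rw [← real_inner_self_eq_norm_sq]
    conv_rhs => rw [genGrad_eq_comb, comb, inner_sum, ← comb, ← genGrad_eq_comb]
    simp only [real_inner_smul_right]
  rw [h4] at h3
  have h5 := h (x + (-t) • S.genGrad x)
  unfold cost at h5
  have h6 : 0 < t * ‖S.genGrad x‖ ^ 2 * (1 - n * t) := by
    have : 0 < 1 - n * t := by linarith
    positivity
  nlinarith

theorem signsStar_eq_signs_of_genGrad_eq_zero {x : EuclideanSpace ℝ (Fin d)}
    (h : S.genGrad x = 0) (hx : S.QPNondegenerate x) : S.signsStar x = S.signs x := by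
  funext i
  by_cases hi : S.signs x i = 0
  · rw [hi, hx.signsStar_eq_zero hi, h, inner_zero_left]
  · exact signsStar_eq_signs hi

/-! ### Sums of powers -/

theorem sum_grad (J : Finset (Fin n)) (hJ : J.Nonempty) (x : EuclideanSpace ℝ (Fin d)) :
    ∑ i ∈ J, S.grad i x = (2 * (J.card : ℝ)) • (x - S.centroid J) := by
  have : (J.card : ℝ) ≠ 0 := by exact_mod_cast hJ.card_pos.ne'
  simp only [grad, ← Finset.smul_sum, Finset.sum_sub_distrib, Finset.sum_const, centroid]
  rw [mul_smul, smul_sub (J.card : ℝ), smul_smul, mul_inv_cancel₀ this, one_smul,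
    ← Nat.cast_smul_eq_nsmul ℝ]

theorem powerSum_add (J : Finset (Fin n)) (x u : EuclideanSpace ℝ (Fin d)) :
    S.powerSum J (x + u) =
      S.powerSum J x + inner ℝ (∑ i ∈ J, S.grad i x) u + J.card * ‖u‖ ^ 2 := by
  simp only [powerSum, power_add, Finset.sum_add_distrib, sum_inner, Finset.sum_const,
    nsmul_eq_mul]

theorem powerSum_eq_centroid (J : Finset (Fin n)) (hJ : J.Nonempty)
    (x : EuclideanSpace ℝ (Fin d)) :
    S.powerSum J x = S.powerSum J (S.centroid J) + J.card * ‖x - S.centroid J‖ ^ 2 := by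
  have := powerSum_add (S := S) J (S.centroid J) (x - S.centroid J)
  rw [sum_grad J hJ, sub_self, smul_zero, inner_zero_left, add_zero, add_sub_cancel] at this
  exact this

theorem IposStar_nonempty {x : EuclideanSpace ℝ (Fin d)} (h : (S.Ipos x).Nonempty) :
    (S.IposStar x).Nonempty := by
  obtain ⟨i, hi⟩ := h
  exact ⟨i, signsStar_eq_one.1 (signsStar_of_pos (mem_Ipos.1 hi))⟩

/-! ### Descent curves -/

/-- `μ` exhibits `comb μ z` as the projection of `∇f_P(z)` to the tangent space at `z` of `S_J`,
where `P` and `J` are given by the signs of the cell entered from `x`. -/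
structure IsMultiplier (S : SphereArrangement d n) (x z : EuclideanSpace ℝ (Fin d))
    (μ : Fin n → ℝ) : Prop where
  nonneg : ∀ i, 0 ≤ μ i
  one : ∀ i, S.signsStar x i = 1 → μ i = 1
  zero : ∀ i, S.signsStar x i = -1 → μ i = 0
  inner_eq : ∀ i, S.signsStar x i = 0 → inner ℝ (S.comb μ z) (S.grad i z) = 0

theorem signs_eq_zero_of_signsStar {x : EuclideanSpace ℝ (Fin d)} {i : Fin n}
    (h : S.signsStar x i = 0) : S.signs x i = 0 := by
  rcases isFace_signs_signsStar x i with h1 | h1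
  · rw [h1, h]
  · exact h1

theorem isMultiplier_weight {x z : EuclideanSpace ℝ (Fin d)}
    (h : S.signsStar z = S.signsStar x) : S.IsMultiplier x z (S.weight z) := by
  have hk := isKKT_weight (S := S) z
  refine ⟨fun i => (weight_mem z i).1, ?_, ?_, ?_⟩ <;> rw [← h]
  · exact hk.one
  · exact hk.zero
  · exact fun i hi => hk.inner_eq i (signs_eq_zero_of_signsStar hi) hi

/-- A curve issuing from `x` in `S_J` along which `f_P` flows along its negative gradient. -/
structure IsDescent (S : SphereArrangement d n) (x : EuclideanSpace ℝ (Fin d))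
    (γ : ℝ → EuclideanSpace ℝ (Fin d)) : Prop where
  start : γ 0 = x
  cont : ContinuousOn γ (Set.Icc 0 1)
  mem : ∀ t ∈ Set.Icc (0 : ℝ) 1, γ t ∈ S.sphereInter (S.IzeroStar x)
  le : ∀ t ∈ Set.Icc (0 : ℝ) 1,
    S.powerSum (S.IposStar x) (γ t) ≤ S.powerSum (S.IposStar x) x
  deriv : ∀ t ∈ Set.Icc (0 : ℝ) 1, ∀ μ, S.IsMultiplier x (γ t) μ → S.comb μ (γ t) ≠ 0 →
    ∃ κ : ℝ, 0 < κ ∧ HasDerivAt γ (-(κ • S.comb μ (γ t))) t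

theorem IsMultiplier.comb_eq_sum {x z : EuclideanSpace ℝ (Fin d)} {μ : Fin n → ℝ}
    (h : S.IsMultiplier x z μ) : S.comb μ z =
      ∑ i ∈ S.IposStar x, S.grad i z + ∑ i ∈ S.IzeroStar x, μ i • S.grad i z := by
  classical
  have : ∀ i, μ i • S.grad i z = (if i ∈ S.IposStar x then S.grad i z else 0) +
      (if i ∈ S.IzeroStar x then μ i • S.grad i z else 0) := by
    intro i
    rcases signType_cases (S.signsStar x i) with hi | hi | hi
    · have h1 : i ∉ S.IzeroStar x := by rw [← signsStar_eq_zero, hi]; decide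
      simp [signsStar_eq_one.1 hi, h1, h.one i hi]
    · have h1 : i ∉ S.IposStar x := by rw [← signsStar_eq_one, hi]; decide
      simp [signsStar_eq_zero.1 hi, h1]
    · have h1 : i ∉ S.IzeroStar x := by rw [← signsStar_eq_zero, hi]; decide
      have h2 : i ∉ S.IposStar x := by rw [← signsStar_eq_one, hi]; decide
      simp [h1, h2, h.zero i hi]
  rw [comb, Finset.sum_congr rfl fun i _ => this i]
  simp [Finset.sum_add_distrib]

theorem isDescent_line {x : EuclideanSpace ℝ (Fin d)} (hx : (S.Ipos x).Nonempty)
    (h0 : S.IzeroStar x = ∅) :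
    S.IsDescent x fun t => x + t • (S.centroid (S.IposStar x) - x) where
  start := by simp
  cont := by fun_prop
  mem t _ i hi := by simp [h0] at hi
  le t ht := by
    have hP := IposStar_nonempty hx
    rw [powerSum_eq_centroid _ hP, powerSum_eq_centroid _ hP x]
    have : x + t • (S.centroid (S.IposStar x) - x) - S.centroid (S.IposStar x) =
        (1 - t) • (x - S.centroid (S.IposStar x)) := by
      module
    rw [this, norm_smul, Real.norm_of_nonneg (sub_nonneg.2 ht.2)]
    have h1 := mul_le_of_le_one_left (norm_nonneg (x - S.centroid (S.IposStar x)))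
      (sub_le_self 1 ht.1)
    have h2 := pow_le_pow_left₀ (mul_nonneg (sub_nonneg.2 ht.2) (norm_nonneg _)) h1 2
    have h3 := mul_le_mul_of_nonneg_left h2 (Nat.cast_nonneg (α := ℝ) (S.IposStar x).card)
    linarith
  deriv t ht μ hμ hne := by
    have hP := IposStar_nonempty hx
    have hder : HasDerivAt (fun t : ℝ => x + t • (S.centroid (S.IposStar x) - x))
        (S.centroid (S.IposStar x) - x) t := by
      simpa using ((hasDerivAt_id t).smul_const (S.centroid (S.IposStar x) - x)).const_add x
    rw [hμ.comb_eq_sum, h0, Finset.sum_empty, add_zero, sum_grad _ hP] at hne ⊢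
    have h1 : x + t • (S.centroid (S.IposStar x) - x) - S.centroid (S.IposStar x) =
        (1 - t) • (x - S.centroid (S.IposStar x)) := by
      module
    rw [h1] at hne ⊢
    have ht1 : t ≠ 1 := by
      rintro rfl
      simp at hne
    have ht2 : 0 < 1 - t := by
      have := lt_of_le_of_ne ht.2 ht1
      linarith
    have hc : (0 : ℝ) < (S.IposStar x).card := by exact_mod_cast hP.card_pos
    refine ⟨(2 * ((S.IposStar x).card : ℝ) * (1 - t))⁻¹, by positivity, ?_⟩
    convert hder using 1
    rw [smul_smul, smul_smul, mul_assoc, inv_mul_cancel₀ (by positivity), one_smul, neg_sub]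

/-! ### Intersections of spheres -/

/-- A linear functional can be prescribed on independent vectors, extended to the whole space and
represented by a vector. -/
theorem exists_inner_grad_eq (hT : S.Transverse) (x : EuclideanSpace ℝ (Fin d))
    (a : Fin n → ℝ) :
    ∃ e : EuclideanSpace ℝ (Fin d), ∀ i, S.power i x = 0 → inner ℝ (S.grad i x) e = a i := by
  have hl := hT x
  obtain ⟨φ, hφ⟩ := LinearMap.exists_extend ((Module.Basis.span hl).constr ℝ
    (fun i : {i : Fin n // S.power i x = 0} => a i))
  refine ⟨(InnerProductSpace.toDual ℝ _).symm (LinearMap.toContinuousLinearMap φ), ?_⟩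
  intro i hi
  rw [real_inner_comm, InnerProductSpace.toDual_symm_apply]
  have h1 := LinearMap.congr_fun hφ (Module.Basis.span hl ⟨i, hi⟩)
  rw [Module.Basis.constr_basis, LinearMap.comp_apply] at h1
  rw [← h1]
  simp [Module.Basis.span_apply]

/-- `c` and `R` are the center and radius of `⋂_{i ∈ J} Sᵢ`. -/
structure IsCenterRadius (S : SphereArrangement d n) (J : Finset (Fin n))
    (c : EuclideanSpace ℝ (Fin d)) (R : ℝ) : Prop where
  mem : c ∈ affineSpan ℝ (S.center '' (J : Set (Fin n)))
  nonneg : 0 ≤ R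
  eq : ∀ i ∈ J, ‖S.center i - c‖ ^ 2 + R ^ 2 = S.radiusSq i

/-- The center is the orthogonal projection of `x` to the affine hull of the centers and the radius
is the distance to it; Pythagoras gives the equations. -/
theorem exists_isCenterRadius {J : Finset (Fin n)} (hJ : J.Nonempty)
    {x : EuclideanSpace ℝ (Fin d)} (hx : x ∈ S.sphereInter J) :
    ∃ c R, S.IsCenterRadius J c R := by
  have hne : (S.center '' (J : Set (Fin n))).Nonempty := by simpa using hJ
  have : Nonempty (affineSpan ℝ (S.center '' (J : Set (Fin n)))) :=
    ((affineSpan_nonempty ℝ).2 hne).to_subtype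
  refine ⟨EuclideanGeometry.orthogonalProjection
    (affineSpan ℝ (S.center '' (J : Set (Fin n)))) x, _,
    EuclideanGeometry.orthogonalProjection_mem x, norm_nonneg (x -
      EuclideanGeometry.orthogonalProjection (affineSpan ℝ (S.center '' (J : Set (Fin n)))) x), ?_⟩
  intro i hi
  have h1 := hx i hi
  have h2 := EuclideanGeometry.dist_sq_eq_dist_orthogonalProjection_sq_add_dist_orthogonalProjection_sq
    (s := affineSpan ℝ (S.center '' (J : Set (Fin n)))) x
    (mem_affineSpan ℝ (Set.mem_image_of_mem S.center (Finset.mem_coe.2 hi)))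
  rw [power] at h1
  simp only [dist_eq_norm] at h2
  rw [norm_sub_rev] at h1
  nlinarith

theorem isCenterRadius_interCenterRadius {J : Finset (Fin n)} (hJ : J.Nonempty)
    {x : EuclideanSpace ℝ (Fin d)} (hx : x ∈ S.sphereInter J) :
    S.IsCenterRadius J (S.interCenterRadius J).1 (S.interCenterRadius J).2 := by
  obtain ⟨c, R, h⟩ := exists_isCenterRadius hJ hx
  have := Classical.epsilon_spec (p := fun p : EuclideanSpace ℝ (Fin d) × ℝ =>
    p.1 ∈ affineSpan ℝ (S.center '' (J : Set (Fin n))) ∧ 0 ≤ p.2 ∧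
      ∀ i ∈ J, ‖S.center i - p.1‖ ^ 2 + p.2 ^ 2 = S.radiusSq i)
    ⟨(c, R), h.mem, h.nonneg, h.eq⟩
  exact ⟨this.1, this.2.1, this.2.2⟩

namespace IsCenterRadius

variable {J : Finset (Fin n)} {c : EuclideanSpace ℝ (Fin d)} {R : ℝ}

/-- An affine function that is constant on the centers takes the same value at `c`. -/
theorem inner_eq (h : S.IsCenterRadius J c R) {q z : EuclideanSpace ℝ (Fin d)} {k : ℝ}
    (hk : ∀ i ∈ J, inner ℝ q (S.center i - z) = k) : inner ℝ q (c - z) = k := by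
  refine affineSpan_induction (p := fun p => inner ℝ q (p - z) = k) h.mem ?_ ?_
  · rintro _ ⟨i, hi, rfl⟩
    exact hk i hi
  · intro a u v w hu hv hw
    have : (a • (u -ᵥ v) +ᵥ w) - z = a • ((u - z) - (v - z)) + (w - z) := by
      simp only [vsub_eq_sub, vadd_eq_add]
      module
    rw [this, inner_add_right, real_inner_smul_right, inner_sub_right, hu, hv, hw]
    ring

/-- The sphere equations say that the affine function `⟨z - c, · - c⟩` has the same value at all
centers. It has that value at `c` too, where it is zero. -/
theorem norm_sub_sq (h : S.IsCenterRadius J c R) {z : EuclideanSpace ℝ (Fin d)}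
    (hz : z ∈ S.sphereInter J) :
    ‖z - c‖ ^ 2 = R ^ 2 ∧ ∀ i ∈ J, inner ℝ (z - c) (S.center i - c) = 0 := by
  have h1 : ∀ i ∈ J, inner ℝ (z - c) (S.center i - c) = (‖z - c‖ ^ 2 - R ^ 2) / 2 := by
    intro i hi
    have h2 := hz i hi
    have h3 := h.eq i hi
    have : z - S.center i = (z - c) - (S.center i - c) := by abel
    rw [power, this, norm_sub_sq_real] at h2
    linarith
  have h2 := h.inner_eq h1
  rw [sub_self, inner_zero_right] at h2
  exact ⟨by linarith, fun i hi => by rw [h1 i hi, ← h2]⟩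

theorem norm_sub (h : S.IsCenterRadius J c R) {z : EuclideanSpace ℝ (Fin d)}
    (hz : z ∈ S.sphereInter J) : ‖z - c‖ = R :=
  (sq_eq_sq₀ (norm_nonneg _) h.nonneg).1 (h.norm_sub_sq hz).1

theorem mem_sphereInter (h : S.IsCenterRadius J c R) {q : EuclideanSpace ℝ (Fin d)}
    (hq : ‖q‖ = R) (hi : ∀ i ∈ J, inner ℝ q (S.center i - c) = 0) :
    c + q ∈ S.sphereInter J := by
  intro i hiJ
  have : c + q - S.center i = q - (S.center i - c) := by abel
  rw [power, this, norm_sub_sq_real, hi i hiJ, hq, ← h.eq i hiJ]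
  ring

/-- With radius zero, `z` would lie in the affine hull of the centers. By transversality some affine
function vanishes at `z` and equals `-1/2` at every center, which is impossible. -/
theorem pos (h : S.IsCenterRadius J c R) (hT : S.Transverse) {z : EuclideanSpace ℝ (Fin d)}
    (hz : z ∈ S.sphereInter J) : 0 < R := by
  refine lt_of_le_of_ne h.nonneg fun h0 => ?_
  have hzc : z = c := by
    rw [← sub_eq_zero, ← norm_eq_zero, h.norm_sub hz, h0]
  obtain ⟨e, he⟩ := exists_inner_grad_eq hT z 1
  have h1 : ∀ i ∈ J, inner ℝ e (S.center i - z) = -1 / 2 := by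
    intro i hi
    have := he i (hz i hi)
    rw [grad, real_inner_smul_left, real_inner_comm, ← neg_sub, inner_neg_right,
      Pi.one_apply] at this
    linarith
  have h2 := h.inner_eq h1
  rw [hzc, sub_self, inner_zero_right] at h2
  norm_num at h2

end IsCenterRadius

section Pole

variable {x z c y : EuclideanSpace ℝ (Fin d)} {R : ℝ} {μ : Fin n → ℝ}

theorem IsMultiplier.inner_sub_center (hμ : S.IsMultiplier x z μ) {i : Fin n}
    (hi : i ∈ S.IzeroStar x) : inner ℝ (S.comb μ z) (S.center i - z) = 0 := by
  have := hμ.inner_eq i (signsStar_eq_zero.2 hi)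
  rw [grad, real_inner_smul_right, ← neg_sub, inner_neg_right] at this
  linarith

theorem IsMultiplier.inner_comb_sub (hμ : S.IsMultiplier x z μ)
    (h : S.IsCenterRadius (S.IzeroStar x) c R) : inner ℝ (S.comb μ z) (z - c) = 0 := by
  have := h.inner_eq (q := S.comb μ z) (z := z) (k := 0) fun i hi => hμ.inner_sub_center hi
  rw [← neg_sub, inner_neg_right, this, neg_zero]

/-- Points of a sphere satisfy `‖z' - z‖² = -2 ⟨z' - z, z - c⟩`, so quadratic terms become linear
and `f_P` is affine on `S_J`. The sum of the `μ i` appears when the gradient of `f_P` is replaced by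
its tangential projection. -/
theorem IsMultiplier.powerSum_eq (hμ : S.IsMultiplier x z μ)
    (h : S.IsCenterRadius (S.IzeroStar x) c R) (hz : z ∈ S.sphereInter (S.IzeroStar x))
    {z' : EuclideanSpace ℝ (Fin d)} (hz' : z' ∈ S.sphereInter (S.IzeroStar x)) :
    S.powerSum (S.IposStar x) z' = S.powerSum (S.IposStar x) z -
      inner ℝ (z' - z) ((2 * (S.IposStar x).card + 2 * ∑ i ∈ S.IzeroStar x, μ i) • (z - c) -
        S.comb μ z) := by
  have h1 := powerSum_add (S := S) (S.IposStar x) z (z' - z)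
  rw [add_sub_cancel] at h1
  have h2 : ∀ i ∈ S.IzeroStar x,
      inner ℝ (μ i • S.grad i z) (z' - z) = - (μ i * ‖z' - z‖ ^ 2) := by
    intro i hi
    have := power_add (S := S) i z (z' - z)
    rw [add_sub_cancel, hz i hi, hz' i hi] at this
    rw [real_inner_smul_left]
    linear_combination (-μ i) * this
  have h3 : inner ℝ (S.comb μ z) (z' - z) = inner ℝ (∑ i ∈ S.IposStar x, S.grad i z) (z' - z) -
      (∑ i ∈ S.IzeroStar x, μ i) * ‖z' - z‖ ^ 2 := by
    rw [hμ.comb_eq_sum, inner_add_left, sum_inner (S.IzeroStar x), Finset.sum_congr rfl h2,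
      Finset.sum_neg_distrib, Finset.sum_mul]
    ring
  have h4 : ‖z' - z‖ ^ 2 = -2 * inner ℝ (z' - z) (z - c) := by
    have h5 := (h.norm_sub_sq hz').1
    rw [← (h.norm_sub_sq hz).1, ← sub_add_sub_cancel z' z c, norm_add_sq_real] at h5
    linarith
  rw [h1, inner_sub_right (z' - z) (_ • _), real_inner_smul_right, real_inner_comm (S.comb μ z), h3,
    h4]
  ring

theorem IsMultiplier.inner_pole (hμ : S.IsMultiplier x z μ)
    (h : S.IsCenterRadius (S.IzeroStar x) c R) (hz : z ∈ S.sphereInter (S.IzeroStar x)) (m : ℝ) :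
    ∀ i ∈ S.IzeroStar x, inner ℝ (m • (z - c) - S.comb μ z) (S.center i - c) = 0 := by
  intro i hi
  have h1 := hμ.inner_sub_center hi
  have h2 := hμ.inner_comb_sub h
  have h3 : inner ℝ (S.comb μ z) (S.center i - c) = 0 := by
    rw [← sub_add_sub_cancel (S.center i) z c, inner_add_right, h1, h2, add_zero]
  rw [inner_sub_left, real_inner_smul_left, (h.norm_sub_sq hz).2 i hi, h3]
  ring

theorem mul_sub_ne_zero {E : Type*} [NormedAddCommGroup E] [InnerProductSpace ℝ E] {u v : E}
    {m : ℝ} (hm : 0 < m) (hu : u ≠ 0) (h : inner ℝ v u = 0) : m • u - v ≠ 0 := by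
  intro h0
  have : inner ℝ (m • u - v) u = 0 := by rw [h0, inner_zero_left]
  rw [inner_sub_left, real_inner_smul_left, h, sub_zero, real_inner_self_eq_norm_sq] at this
  have : 0 < m * ‖u‖ ^ 2 := by positivity
  linarith

/-- The affine function `f_P` on `S_J` decreases in the direction `w = m (z - c) - comb μ z`. This
`w` is orthogonal to all `cᵢ - c`, and nonzero since the second term is orthogonal to `z - c`. The
minimum is therefore at the pole `c + R w / ‖w‖`, by Cauchy–Schwarz. -/
theorem IsMultiplier.exists_isMinOn (hμ : S.IsMultiplier x z μ) (hx : (S.Ipos x).Nonempty)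
    (h : S.IsCenterRadius (S.IzeroStar x) c R) (hR : 0 < R)
    (hz : z ∈ S.sphereInter (S.IzeroStar x)) :
    ∃ y ∈ S.sphereInter (S.IzeroStar x), ∀ z' ∈ S.sphereInter (S.IzeroStar x),
      S.powerSum (S.IposStar x) y ≤ S.powerSum (S.IposStar x) z' := by
  have hm : (0 : ℝ) < 2 * (S.IposStar x).card + 2 * ∑ i ∈ S.IzeroStar x, μ i := by
    have h1 : (0 : ℝ) < (S.IposStar x).card := by
      exact_mod_cast (IposStar_nonempty hx).card_pos
    have h2 := Finset.sum_nonneg fun i (_ : i ∈ S.IzeroStar x) => hμ.nonneg i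
    linarith
  set m := 2 * ((S.IposStar x).card : ℝ) + 2 * ∑ i ∈ S.IzeroStar x, μ i with hmdef
  have hu : z - c ≠ 0 := by
    rw [← norm_ne_zero_iff, h.norm_sub hz]; exact hR.ne'
  have hw := mul_sub_ne_zero hm hu (hμ.inner_comb_sub h)
  set w := m • (z - c) - S.comb μ z with hwdef
  have hwn : 0 < ‖w‖ := norm_pos_iff.2 hw
  have hy : c + (R / ‖w‖) • w ∈ S.sphereInter (S.IzeroStar x) := by
    refine h.mem_sphereInter ?_ fun i hi => ?_
    · rw [norm_smul, Real.norm_of_nonneg (by positivity)]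
      field_simp
    · rw [real_inner_smul_left, hμ.inner_pole h hz m i hi, mul_zero]
  refine ⟨_, hy, fun z' hz' => ?_⟩
  rw [hμ.powerSum_eq h hz hy, hμ.powerSum_eq h hz hz', ← hmdef, ← hwdef]
  have h1 : inner ℝ (z' - c) w ≤ R * ‖w‖ := by
    rw [← h.norm_sub hz']
    exact real_inner_le_norm _ _
  have h2 : inner ℝ ((R / ‖w‖) • w) w = R * ‖w‖ := by
    rw [real_inner_smul_left, real_inner_self_eq_norm_sq]
    field_simp
  have h3 : c + (R / ‖w‖) • w - z = (R / ‖w‖) • w - (z - c) := by abel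
  rw [h3, ← sub_sub_sub_cancel_right z' z c, inner_sub_left _ (z - c), inner_sub_left _ (z - c), h2]
  linarith

/-- The minimizer of `f_P` on the sphere `S_J`, seen from an arbitrary point of `S_J`. -/
theorem IsMultiplier.sub_center_eq (hμ : S.IsMultiplier x z μ) (hx : (S.Ipos x).Nonempty)
    (h : S.IsCenterRadius (S.IzeroStar x) c R) (hR : 0 < R)
    (hz : z ∈ S.sphereInter (S.IzeroStar x)) (hy : y ∈ S.sphereInter (S.IzeroStar x))
    (hmin : ∀ z' ∈ S.sphereInter (S.IzeroStar x),
      S.powerSum (S.IposStar x) y ≤ S.powerSum (S.IposStar x) z') :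
    ∃ κ m : ℝ, 0 < κ ∧ 0 < m ∧ y - c = κ • (m • (z - c) - S.comb μ z) ∧
      ∀ z' ∈ S.sphereInter (S.IzeroStar x), S.powerSum (S.IposStar x) z' =
        S.powerSum (S.IposStar x) z - κ⁻¹ * inner ℝ (z' - z) (y - c) := by
  have hm : (0 : ℝ) < 2 * (S.IposStar x).card + 2 * ∑ i ∈ S.IzeroStar x, μ i := by
    have h1 : (0 : ℝ) < (S.IposStar x).card := by
      exact_mod_cast (IposStar_nonempty hx).card_pos
    have h2 := Finset.sum_nonneg fun i (_ : i ∈ S.IzeroStar x) => hμ.nonneg i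
    linarith
  set m := 2 * ((S.IposStar x).card : ℝ) + 2 * ∑ i ∈ S.IzeroStar x, μ i with hmdef
  have hu : z - c ≠ 0 := by
    rw [← norm_ne_zero_iff, h.norm_sub hz]; exact hR.ne'
  have hw := mul_sub_ne_zero hm hu (hμ.inner_comb_sub h)
  set w := m • (z - c) - S.comb μ z with hwdef
  have hwn : 0 < ‖w‖ := norm_pos_iff.2 hw
  have hp : c + (R / ‖w‖) • w ∈ S.sphereInter (S.IzeroStar x) := by
    refine h.mem_sphereInter ?_ fun i hi => ?_
    · rw [norm_smul, Real.norm_of_nonneg (by positivity)]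
      field_simp
    · rw [real_inner_smul_left, hμ.inner_pole h hz m i hi, mul_zero]
  have hle := hmin _ hp
  rw [hμ.powerSum_eq h hz hy, hμ.powerSum_eq h hz hp, ← hmdef, ← hwdef] at hle
  have h2 : inner ℝ ((R / ‖w‖) • w) w = R * ‖w‖ := by
    rw [real_inner_smul_left, real_inner_self_eq_norm_sq]
    field_simp
  have h3 : c + (R / ‖w‖) • w - z = (R / ‖w‖) • w - (z - c) := by abel
  rw [h3, ← sub_sub_sub_cancel_right y z c, inner_sub_left _ (z - c), inner_sub_left _ (z - c),
    h2] at hle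
  have hyn := h.norm_sub hy
  have h1 : inner ℝ (y - c) w = ‖y - c‖ * ‖w‖ := by
    refine le_antisymm (real_inner_le_norm _ _) ?_
    rw [hyn]
    linarith
  rw [inner_eq_norm_mul_iff_real, hyn] at h1
  have hyc : y - c = (R / ‖w‖) • w := by
    rw [div_eq_inv_mul, mul_smul, ← h1, smul_smul, inv_mul_cancel₀ hwn.ne', one_smul]
  refine ⟨R / ‖w‖, m, by positivity, hm, hyc, fun z' hz' => ?_⟩
  rw [hμ.powerSum_eq h hz hz', hyc, ← hmdef, ← hwdef, real_inner_smul_right]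
  field_simp

end Pole

/-! ### Geodesics as descent curves -/

theorem hasDerivAt_div_norm_smul {E : Type*} [NormedAddCommGroup E] [InnerProductSpace ℝ E]
    {l : ℝ → E} {l' : E} {t : ℝ} (R : ℝ) (hl : HasDerivAt l l' t) (h0 : l t ≠ 0) :
    HasDerivAt (fun s => (R / ‖l s‖) • l s)
      ((R / ‖l t‖) • (l' - (inner ℝ (l t) l' / ‖l t‖ ^ 2) • l t)) t := by
  have hn : ‖l t‖ ≠ 0 := norm_ne_zero_iff.2 h0
  have h1 : HasDerivAt (fun s => ‖l s‖) (inner ℝ (l t) l' / ‖l t‖) t := by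
    have h := (hl.norm_sq).sqrt (by positivity)
    simp only [Real.sqrt_sq (norm_nonneg _)] at h
    convert h using 1
    field_simp
  have h2 := ((hasDerivAt_const t R).div h1 hn).smul hl
  refine h2.congr_deriv ?_
  rw [smul_sub, smul_smul, sub_eq_add_neg (_ • _), ← neg_smul, Pi.div_apply]
  congr 2
  field_simp
  ring

theorem geodesic_zero (c : EuclideanSpace ℝ (Fin d)) {R : ℝ} (hR : 0 < R)
    {x : EuclideanSpace ℝ (Fin d)} (hx : ‖x - c‖ = R) (y : EuclideanSpace ℝ (Fin d)) :
    geodesic c R x y 0 = x := by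
  simp [geodesic, hx, hR.ne']

theorem geodesic_one (c : EuclideanSpace ℝ (Fin d)) {R : ℝ} (hR : 0 < R)
    {y : EuclideanSpace ℝ (Fin d)} (hy : ‖y - c‖ = R) (x : EuclideanSpace ℝ (Fin d)) :
    geodesic c R x y 1 = y := by
  simp [geodesic, hy, hR.ne']

/-- The minimizer is the pole of an affine function on the sphere, and great circles towards the
pole are its gradient lines. The angle between `x - c` and `y - c` is acute, so the chord avoids the
center and can be projected. -/
theorem isDescent_geodesic {x y c : EuclideanSpace ℝ (Fin d)} {R : ℝ} {μ : Fin n → ℝ}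
    (hx : (S.Ipos x).Nonempty) (hμ : S.IsMultiplier x x μ)
    (h : S.IsCenterRadius (S.IzeroStar x) c R) (hR : 0 < R)
    (hxS : x ∈ S.sphereInter (S.IzeroStar x)) (hy : y ∈ S.sphereInter (S.IzeroStar x))
    (hmin : ∀ z' ∈ S.sphereInter (S.IzeroStar x),
      S.powerSum (S.IposStar x) y ≤ S.powerSum (S.IposStar x) z') :
    S.IsDescent x (geodesic c R x y) := by
  obtain ⟨κ, m, hκ, hm, hyc, hpow⟩ := hμ.sub_center_eq hx h hR hxS hy hmin
  have hxn := h.norm_sub hxS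
  have hyn := h.norm_sub hy
  have hxy : 0 < inner ℝ (x - c) (y - c) := by
    rw [hyc, real_inner_smul_right, inner_sub_right, real_inner_smul_right,
      real_inner_comm, real_inner_comm (S.comb μ x), hμ.inner_comb_sub h,
      real_inner_self_eq_norm_sq, hxn]
    have : 0 < κ * (m * R ^ 2) := by positivity
    linarith
  have hxy2 : inner ℝ (x - c) (y - c) ≤ R ^ 2 := by
    have := real_inner_le_norm (x - c) (y - c)
    rw [hxn, hyn] at this
    linarith
  have hl : ∀ t : ℝ, (1 - t) • x + t • y - c = (1 - t) • (x - c) + t • (y - c) := by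
    intro t
    module
  have hly : ∀ t : ℝ, inner ℝ ((1 - t) • x + t • y - c) (y - c) =
      (1 - t) * inner ℝ (x - c) (y - c) + t * R ^ 2 := by
    intro t
    rw [hl, inner_add_left, real_inner_smul_left, real_inner_smul_left (y - c),
      real_inner_self_eq_norm_sq, hyn]
  have hly' : ∀ t ∈ Set.Icc (0 : ℝ) 1,
      inner ℝ (x - c) (y - c) ≤ inner ℝ ((1 - t) • x + t • y - c) (y - c) := by
    intro t ht
    rw [hly]
    nlinarith [mul_nonneg ht.1 (sub_nonneg.2 hxy2)]
  have hne : ∀ t ∈ Set.Icc (0 : ℝ) 1, (1 - t) • x + t • y - c ≠ 0 := by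
    intro t ht h0
    have := hly' t ht
    rw [h0, inner_zero_left] at this
    linarith
  have hpos : ∀ t ∈ Set.Icc (0 : ℝ) 1, 0 < ‖(1 - t) • x + t • y - c‖ :=
    fun t ht => norm_pos_iff.2 (hne t ht)
  have hmem : ∀ t ∈ Set.Icc (0 : ℝ) 1, geodesic c R x y t ∈ S.sphereInter (S.IzeroStar x) := by
    intro t ht
    have hp := hpos t ht
    refine h.mem_sphereInter ?_ fun i hi => ?_
    · rw [norm_smul, Real.norm_of_nonneg (by positivity)]
      field_simp
    · rw [real_inner_smul_left, hl, inner_add_left, real_inner_smul_left,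
        real_inner_smul_left (y - c), (h.norm_sub_sq hxS).2 i hi, (h.norm_sub_sq hy).2 i hi]
      ring
  refine ⟨geodesic_zero c hR hxn y, ?_, hmem, ?_, ?_⟩
  · unfold geodesic
    have h1 : Continuous fun t : ℝ => (1 - t) • x + t • y - c := by fun_prop
    exact continuousOn_const.add (((continuousOn_const.div h1.norm.continuousOn
      fun t ht => (hpos t ht).ne')).smul h1.continuousOn)
  · intro t ht
    rw [hpow _ (hmem t ht)]
    have h1 : geodesic c R x y t - x =
        (R / ‖(1 - t) • x + t • y - c‖) • ((1 - t) • x + t • y - c) - (x - c) := by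
      rw [geodesic]
      abel
    have h2 : ‖(1 - t) • x + t • y - c‖ ≤ R := by
      rw [hl]
      refine (norm_add_le _ _).trans ?_
      rw [norm_smul, norm_smul, hxn, hyn, Real.norm_of_nonneg ht.1,
        Real.norm_of_nonneg (sub_nonneg.2 ht.2)]
      linarith
    have h3 : 1 ≤ R / ‖(1 - t) • x + t • y - c‖ := (one_le_div (hpos t ht)).2 h2
    have h4 : 0 ≤ inner ℝ (geodesic c R x y t - x) (y - c) := by
      rw [h1, inner_sub_left _ (x - c), real_inner_smul_left]
      have h5 := hly' t ht
      have h6 := le_mul_of_one_le_left (hxy.le.trans h5) h3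
      linarith
    have : 0 ≤ κ⁻¹ * inner ℝ (geodesic c R x y t - x) (y - c) := by positivity
    linarith
  · intro t ht ν hν hνne
    obtain ⟨k, m', hk, hm', hyc', -⟩ := hν.sub_center_eq hx h hR (hmem t ht) hy hmin
    have horth := hν.inner_comb_sub h
    set z := geodesic c R x y t with hz
    set v := S.comb ν z with hv
    set l := (1 - t) • x + t • y - c with hldef
    have hlpos : 0 < ‖l‖ := hpos t ht
    have hzn : ‖z - c‖ = R := h.norm_sub (hmem t ht)
    have hzl : z - c = (R / ‖l‖) • l := by
      rw [hz, geodesic, add_sub_cancel_left]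
    have hlz : l = (‖l‖ / R) • (z - c) := by
      rw [hzl, smul_smul]
      field_simp
      rw [one_smul]
    -- At `t = 1` the curve is at the minimizer, where `v` would be both parallel and orthogonal to
    -- `z - c`, hence zero.
    have ht1 : t ≠ 1 := by
      intro h1
      have hzy : z = y := by rw [hz, h1, geodesic_one c hR hyn]
      rw [← hzy] at hyc'
      have h2 : k • v = (k * m' - 1) • (z - c) := by
        have : k • v = (k * m') • (z - c) - k • (m' • (z - c) - v) := by module
        rw [this, ← hyc']
        module
      have h3 : k * ‖v‖ ^ 2 = 0 := by
        rw [← real_inner_self_eq_norm_sq, ← real_inner_smul_right, h2, real_inner_smul_right,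
          horth, mul_zero]
      have : 0 < k * ‖v‖ ^ 2 := by positivity
      linarith
    have ht2 : 0 < 1 - t := by
      have := lt_of_le_of_ne ht.2 ht1
      linarith
    have hder : HasDerivAt (fun s : ℝ => (1 - s) • x + s • y - c) (y - x) t := by
      have h1 := (((hasDerivAt_id t).const_sub 1).smul_const x).add
        ((hasDerivAt_id t).smul_const y)
      exact (h1.sub_const c).congr_deriv (by module)
    have hgeo := (hasDerivAt_div_norm_smul R hder (hne t ht)).const_add c
    rw [← hldef] at hgeo
    -- Since `(1 - t) (y - x) = (y - c) - l` and `y - c = k (m' (z - c) - v)`, removing the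
    -- component along `z - c` from `y - x` leaves `-(1 - t)⁻¹ k v`; radial projection scales it by
    -- `R / ‖l‖`.
    refine ⟨k * (R / ‖l‖) * (1 - t)⁻¹, by positivity, ?_⟩
    refine hgeo.congr_deriv ?_
    have hyx : y - x = (1 - t)⁻¹ • ((k * m' - ‖l‖ / R) • (z - c) - k • v) := by
      have h1 : (1 - t) • (y - x) = (y - c) - l := by
        rw [hldef]
        module
      rw [hyc', hlz] at h1
      have h2 : y - x = (1 - t)⁻¹ • ((1 - t) • (y - x)) := by
        rw [smul_smul, inv_mul_cancel₀ ht2.ne', one_smul]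
      rw [h2, h1]
      module
    have hin : inner ℝ l (y - x) = (1 - t)⁻¹ * ((k * m' - ‖l‖ / R) * (‖l‖ * R)) := by
      conv_lhs => rw [hlz]
      rw [hyx, real_inner_smul_left, real_inner_smul_right, inner_sub_right,
        real_inner_smul_right, real_inner_smul_right, real_inner_comm v, horth,
        real_inner_self_eq_norm_sq, hzn]
      field_simp
      ring
    have hcoef : inner ℝ l (y - x) / ‖l‖ ^ 2 * (‖l‖ / R) = (1 - t)⁻¹ * (k * m' - ‖l‖ / R) := by
      rw [hin]
      field_simp
    have hlast : (inner ℝ l (y - x) / ‖l‖ ^ 2) • l =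
        ((1 - t)⁻¹ * (k * m' - ‖l‖ / R)) • (z - c) := by
      rw [← hcoef, mul_smul, ← hlz]
    rw [hlast, hyx]
    module

/-! ### Entering and leaving a cell along a descent curve -/

theorem sign_eq_iff_mul_pos {s : SignType} (hs : s ≠ 0) {p : ℝ} :
    SignType.sign p = s ↔ 0 < (s : ℝ) * p := by
  rcases signType_cases s with rfl | rfl | rfl
  · simp [sign_eq_one_iff]
  · exact absurd rfl hs
  · simp [sign_eq_neg_one_iff]

theorem eventually_slope_pos {φ : ℝ → ℝ} {φ' t : ℝ} (h : HasDerivAt φ φ' t) (hpos : 0 < φ') :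
    ∀ᶠ s in 𝓝[≠] t, 0 < (s - t) * (φ s - φ t) := by
  have h1 := (hasDerivAt_iff_tendsto_slope.1 h).eventually (eventually_gt_nhds hpos)
  filter_upwards [h1, self_mem_nhdsWithin] with s hs hst
  have hne : s - t ≠ 0 := sub_ne_zero.2 hst
  rw [slope_def_field] at hs
  have h2 : (s - t) * (φ s - φ t) = (φ s - φ t) / (s - t) * (s - t) ^ 2 := by
    field_simp
  rw [h2]
  positivity

/-- Strict complementarity: optimality gives the weak inequality and non-degeneracy excludes zero.
Moving against the generalized gradient thus pushes the power strictly to the prescribed side. -/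
theorem QPNondegenerate.mul_inner_neg {z : EuclideanSpace ℝ (Fin d)} (h : S.QPNondegenerate z)
    {i : Fin n} (hi : S.signs z i = 0) (hs : S.signsStar z i ≠ 0) :
    (S.signsStar z i : ℝ) * inner ℝ (S.genGrad z) (S.grad i z) < 0 := by
  have hk := isKKT_weight (S := S) z
  have hne : inner ℝ (S.genGrad z) (S.grad i z) ≠ 0 := by
    rwa [Ne, ← h.signsStar_eq_zero hi]
  rcases signType_cases (S.signsStar z i) with h1 | h1 | h1
  · have := hk.inner_nonpos i hi h1
    rw [← genGrad_eq_comb] at this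
    rw [h1]
    simpa using lt_of_le_of_ne this hne
  · exact absurd h1 hs
  · have := hk.inner_nonneg i hi h1
    rw [← genGrad_eq_comb] at this
    rw [h1]
    simpa using lt_of_le_of_ne this hne.symm

namespace IsDescent

variable {x : EuclideanSpace ℝ (Fin d)} {γ : ℝ → EuclideanSpace ℝ (Fin d)}

theorem mem_cellStar_iff (h : S.IsDescent x γ) {t : ℝ} (ht : t ∈ Set.Icc (0 : ℝ) 1) :
    γ t ∈ S.cellStar x ↔
      ∀ i, S.signsStar x i ≠ 0 → 0 < (S.signsStar x i : ℝ) * S.power i (γ t) := by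
  rw [mem_cellStar]
  constructor
  · intro he i hi
    rw [← sign_eq_iff_mul_pos hi]
    exact congrFun he i
  · intro hp
    funext i
    by_cases hi : S.signsStar x i = 0
    · rw [hi, signs_eq_zero]
      exact h.mem t ht i (signsStar_eq_zero.1 hi)
    · exact (sign_eq_iff_mul_pos hi).2 (hp i hi)

theorem continuousOn_mul_power (h : S.IsDescent x γ) (i : Fin n) :
    ContinuousOn (fun t => (S.signsStar x i : ℝ) * S.power i (γ t)) (Set.Icc 0 1) :=
  continuousOn_const.mul ((continuous_power i).comp_continuousOn h.cont)

/-- At a point of the curve from which the descent enters the cell entered from `x`, the powers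
vanishing at that point move away from zero with the sign prescribed by the cell. -/
theorem exists_hasDerivAt (h : S.IsDescent x γ) {t : ℝ} (ht : t ∈ Set.Icc (0 : ℝ) 1)
    (hs : S.signsStar (γ t) = S.signsStar x) (hnd : S.QPNondegenerate (γ t))
    (hne : S.genGrad (γ t) ≠ 0) {i : Fin n} (hi : S.signs (γ t) i = 0)
    (hsi : S.signsStar x i ≠ 0) :
    ∃ φ' : ℝ, 0 < φ' ∧
      HasDerivAt (fun t => (S.signsStar x i : ℝ) * S.power i (γ t)) φ' t := by
  rw [genGrad_eq_comb] at hne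
  obtain ⟨κ, hκ, hder⟩ := h.deriv t ht _ (isMultiplier_weight hs) hne
  refine ⟨_, ?_, (hasDerivAt_power hder i).const_mul _⟩
  rw [← hs] at hsi
  have h1 := hnd.mul_inner_neg hi hsi
  rw [← genGrad_eq_comb, inner_neg_right, real_inner_smul_right, real_inner_comm, ← hs]
  nlinarith

theorem eventually_mem (h : S.IsDescent x γ) (hnd : S.QPNondegenerate x)
    (hne : S.genGrad x ≠ 0) : ∀ᶠ t in 𝓝[>] (0 : ℝ), γ t ∈ S.cellStar x := by
  have h01 : (0 : ℝ) ∈ Set.Icc (0 : ℝ) 1 := ⟨le_rfl, zero_le_one⟩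
  have hIcc : ∀ᶠ t in 𝓝[>] (0 : ℝ), t ∈ Set.Icc (0 : ℝ) 1 := by
    filter_upwards [Ioc_mem_nhdsGT zero_lt_one] with t ht
    exact ⟨ht.1.le, ht.2⟩
  have hall : ∀ᶠ t in 𝓝[>] (0 : ℝ), ∀ i, S.signsStar x i ≠ 0 →
      0 < (S.signsStar x i : ℝ) * S.power i (γ t) := by
    refine eventually_all.2 fun i => ?_
    by_cases hi : S.signsStar x i = 0
    · simp [hi]
    simp only [Ne, hi, not_false_eq_true, true_imp_iff]
    by_cases hx : S.signs x i = 0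
    · obtain ⟨φ', hφ, hder⟩ := h.exists_hasDerivAt h01 (by rw [h.start]) (by rwa [h.start])
        (by rwa [h.start]) (by rwa [h.start]) hi
      have h1 := eventually_slope_pos hder hφ
      have h2 : 𝓝[>] (0 : ℝ) ≤ 𝓝[≠] 0 := nhdsWithin_mono _ fun t ht => ne_of_gt ht
      filter_upwards [h1.filter_mono h2, self_mem_nhdsWithin] with t ht1 ht2
      have ht2 : 0 < t := ht2
      rw [h.start, signs_eq_zero.1 hx, mul_zero, sub_zero, sub_zero] at ht1
      exact pos_of_mul_pos_right ht1 ht2.le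
    · have h1 := (h.continuousOn_mul_power i 0 h01).eventually
        (eventually_gt_nhds (b := 0) (by
          beta_reduce
          rw [h.start, ← sign_eq_iff_mul_pos hi]
          exact (signsStar_eq_signs hx).symm))
      exact h1.filter_mono (nhdsWithin_le_iff.2 hIcc)
  filter_upwards [hall, hIcc] with t ht1 ht2
  exact (h.mem_cellStar_iff ht2).2 ht1

/-- The first exit from the cell entered from `x`. -/
theorem exit (h : S.IsDescent x γ) (hnd : S.QPNondegenerate x) (hne : S.genGrad x ≠ 0)
    (h1 : γ 1 ∉ S.cellStar x) {T : Set ℝ} (hT : ∀ t ∈ T, 0 < t)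
    (hT' : ∀ t ∈ Set.Icc (0 : ℝ) 1, t ∈ T ↔ 0 < t ∧ γ t ∉ S.cellStar x) :
    0 < sInf T ∧ sInf T ≤ 1 ∧ γ (sInf T) ∉ S.cellStar x ∧
      ∀ t, 0 < t → t < sInf T → γ t ∈ S.cellStar x := by
  have hbdd : BddBelow T := ⟨0, fun t ht => (hT t ht).le⟩
  have h1T : (1 : ℝ) ∈ T := (hT' 1 ⟨zero_le_one, le_rfl⟩).2 ⟨zero_lt_one, h1⟩
  have hle : sInf T ≤ 1 := csInf_le hbdd h1T
  obtain ⟨ε, hε, hmem⟩ := (mem_nhdsGT_iff_exists_Ioo_subset).1 (h.eventually_mem hnd hne)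
  have hε : 0 < ε := hε
  have hpos : 0 < sInf T := by
    refine lt_of_lt_of_le (lt_min hε zero_lt_one) (le_csInf ⟨1, h1T⟩ fun t ht => ?_)
    by_contra hlt
    push Not at hlt
    have h0 := hT t ht
    exact ((hT' t ⟨h0.le, (hlt.trans_le (min_le_right _ _)).le⟩).1 ht).2
      (hmem ⟨h0, hlt.trans_le (min_le_left _ _)⟩)
  have hIoo : ∀ t, 0 < t → t < sInf T → γ t ∈ S.cellStar x := by
    intro t h0 hlt
    by_contra hc
    exact notMem_of_lt_csInf hlt hbdd ((hT' t ⟨h0.le, (hlt.trans_le hle).le⟩).2 ⟨h0, hc⟩)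
  refine ⟨hpos, hle, fun hc => ?_, hIoo⟩
  have hI : sInf T ∈ Set.Icc (0 : ℝ) 1 := ⟨hpos.le, hle⟩
  have hev : ∀ᶠ t in 𝓝[Set.Icc 0 1] (sInf T), γ t ∈ S.cellStar x := by
    have hall : ∀ᶠ t in 𝓝[Set.Icc 0 1] (sInf T), ∀ i, S.signsStar x i ≠ 0 →
        0 < (S.signsStar x i : ℝ) * S.power i (γ t) := by
      refine eventually_all.2 fun i => ?_
      by_cases hi : S.signsStar x i = 0
      · simp [hi]
      simp only [Ne, hi, not_false_eq_true, true_imp_iff]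
      exact (h.continuousOn_mul_power i _ hI).eventually
        (eventually_gt_nhds ((h.mem_cellStar_iff hI).1 hc i hi))
    filter_upwards [hall, self_mem_nhdsWithin] with t ht1 ht2
    exact (h.mem_cellStar_iff ht2).2 ht1
  obtain ⟨δ, hδ, hball⟩ := Metric.mem_nhdsWithin_iff.1 hev
  obtain ⟨t, htT, htlt⟩ := exists_lt_of_csInf_lt ⟨1, h1T⟩ (lt_add_of_pos_right (sInf T) hδ)
  have hge := csInf_le hbdd htT
  -- Nothing is known about `T` beyond 1. But if `t > 1`, then 1 lies between `sInf T` and `t`,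
  -- hence in the ball, and `γ 1` is outside the cell.
  rcases le_or_gt t 1 with ht1 | ht1
  · have hIt : t ∈ Set.Icc (0 : ℝ) 1 := ⟨hpos.le.trans hge, ht1⟩
    refine ((hT' t hIt).1 htT).2 (hball ⟨?_, hIt⟩)
    rw [Metric.mem_ball, Real.dist_eq, abs_lt]
    constructor <;> linarith
  · refine h1 (hball ⟨?_, zero_le_one, le_rfl⟩)
    rw [Metric.mem_ball, Real.dist_eq, abs_lt]
    constructor <;> linarith

variable {t₁ : ℝ}

theorem isFace_exit (h : S.IsDescent x γ) (h0 : 0 < t₁) (h1 : t₁ ≤ 1)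
    (hIoo : ∀ t, 0 < t → t < t₁ → γ t ∈ S.cellStar x) :
    IsFace (S.signs (γ t₁)) (S.signsStar x) := by
  intro i
  have hI : t₁ ∈ Set.Icc (0 : ℝ) 1 := ⟨h0.le, h1⟩
  by_cases hi : S.signsStar x i = 0
  · left
    rw [hi, signs_eq_zero]
    exact h.mem _ hI i (signsStar_eq_zero.1 hi)
  have hge : 0 ≤ (S.signsStar x i : ℝ) * S.power i (γ t₁) := by
    have hc : Tendsto (fun t => (S.signsStar x i : ℝ) * S.power i (γ t)) (𝓝[<] t₁)
        (𝓝 ((S.signsStar x i : ℝ) * S.power i (γ t₁))) := by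
      refine (h.continuousOn_mul_power i _ hI).mono_left (nhdsWithin_le_iff.2 ?_)
      filter_upwards [Ioo_mem_nhdsLT h0] with t ht
      exact ⟨ht.1.le, ht.2.le.trans h1⟩
    refine ge_of_tendsto hc ?_
    filter_upwards [Ioo_mem_nhdsLT h0] with t ht
    exact ((h.mem_cellStar_iff ⟨ht.1.le, ht.2.le.trans h1⟩).1 (hIoo t ht.1 ht.2) i hi).le
  rcases eq_or_lt_of_le hge with he | hl
  · right
    rw [signs_eq_zero]
    have : (S.signsStar x i : ℝ) ≠ 0 := by
      rcases signType_cases (S.signsStar x i) with h2 | h2 | h2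
      · simp [h2]
      · exact absurd h2 hi
      · simp [h2]
    exact (mul_eq_zero.1 he.symm).resolve_left this
  · left
    exact (sign_eq_iff_mul_pos hi).2 hl

/-- If descent from the exit point entered the same cell, a newly vanishing signed power would have
positive derivative there, hence negative values just before; inside the cell these values are
positive. -/
theorem signsStar_exit_ne (h : S.IsDescent x γ) (h0 : 0 < t₁) (h1 : t₁ ≤ 1)
    (hIoo : ∀ t, 0 < t → t < t₁ → γ t ∈ S.cellStar x) (hout : γ t₁ ∉ S.cellStar x)
    (hnd : S.QPNondegenerate (γ t₁)) (hne : S.genGrad (γ t₁) ≠ 0) :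
    S.signsStar (γ t₁) ≠ S.signsStar x := by
  intro hs
  have hI : t₁ ∈ Set.Icc (0 : ℝ) 1 := ⟨h0.le, h1⟩
  rw [mem_cellStar] at hout
  obtain ⟨i, hi⟩ := Function.ne_iff.1 hout
  have hzero := (h.isFace_exit h0 h1 hIoo i).resolve_left hi
  have hsi : S.signsStar x i ≠ 0 := by rw [← hzero]; exact hi.symm
  obtain ⟨φ', hφ, hder⟩ := h.exists_hasDerivAt hI hs hnd hne hzero hsi
  have h2 : 𝓝[<] t₁ ≤ 𝓝[≠] t₁ := nhdsWithin_mono _ fun t ht => ne_of_lt ht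
  obtain ⟨t, ht1, ht2⟩ := (((eventually_slope_pos hder hφ).filter_mono h2).and
    (Ioo_mem_nhdsLT h0)).exists
  have h3 := (h.mem_cellStar_iff ⟨ht2.1.le, ht2.2.le.trans h1⟩).1 (hIoo t ht2.1 ht2.2) i hsi
  rw [signs_eq_zero.1 hzero, mul_zero, sub_zero] at ht1
  nlinarith [ht2.2]

end IsDescent

/-! ### One step of the algorithm near the minimizer -/

/-- A transverse arrangement whose balls have no common point, with the minimizer `p` of its cost
and a sublevel set of the cost on which the quadratic program is non-degenerate and which meets
only the spheres through `p`. -/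
structure IsLocalModel (S : SphereArrangement d n) (p : EuclideanSpace ℝ (Fin d))
    (δ : ℝ) : Prop where
  transverse : S.Transverse
  nonempty : ∀ x, (S.Ipos x).Nonempty
  isMin : ∀ y, S.cost p ≤ S.cost y
  pos : 0 < δ
  nondeg : ∀ x, S.cost x < S.cost p + δ → S.QPNondegenerate x
  signs_eq : ∀ x, S.cost x < S.cost p + δ → ∀ i, S.signs p i ≠ 0 → S.signs x i = S.signs p i
  signsStar_eq : ∀ x, S.cost x < S.cost p + δ → S.signs x = S.signs p → S.signsStar x = S.signs p

namespace IsLocalModel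

variable {p x : EuclideanSpace ℝ (Fin d)} {δ : ℝ}

theorem genGrad_eq_zero (h : S.IsLocalModel p δ) : S.genGrad p = 0 :=
  genGrad_eq_zero_of_isMin h.isMin

theorem cost_self_lt (h : S.IsLocalModel p δ) : S.cost p < S.cost p + δ := by
  linarith [h.pos]

theorem signsStar_self (h : S.IsLocalModel p δ) : S.signsStar p = S.signs p :=
  signsStar_eq_signs_of_genGrad_eq_zero h.genGrad_eq_zero (h.nondeg p h.cost_self_lt)

theorem genGrad_ne_zero (h : S.IsLocalModel p δ) (hx : x ≠ p) : S.genGrad x ≠ 0 := fun h0 =>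
  hx (eq_of_cost_le (h.nonempty x) h0 (h.isMin x)).symm

theorem isFace_signs (h : S.IsLocalModel p δ) (hx : S.cost x < S.cost p + δ) :
    IsFace (S.signs p) (S.signsStar x) := by
  intro i
  by_cases hi : S.signs p i = 0
  · exact Or.inr hi
  · left
    have h1 := h.signs_eq x hx i hi
    rw [← h1] at hi ⊢
    exact (signsStar_eq_signs hi).symm

theorem mem_sphereInter (h : S.IsLocalModel p δ) (hx : S.cost x < S.cost p + δ) :
    p ∈ S.sphereInter (S.IzeroStar x) := by
  intro i hi
  rw [← signs_eq_zero]
  rcases h.isFace_signs hx i with h1 | h1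
  · rw [h1, signsStar_eq_zero.2 hi]
  · exact h1

/-- Both `y` and `p` lie in the closure of the cell, where the cost is `f_P`. So a target point
lying in its cell is already the global minimizer. -/
theorem eq_of_mem_cellStar (h : S.IsLocalModel p δ) (hx : S.cost x < S.cost p + δ)
    {y : EuclideanSpace ℝ (Fin d)} (hy : y ∈ S.cellStar x)
    (hle : S.powerSum (S.IposStar x) y ≤ S.powerSum (S.IposStar x) p) : y = p := by
  refine eq_of_cost_le (h.nonempty p) h.genGrad_eq_zero ?_
  rw [cost_eq_powerSum (h.isFace_signs hx), cost_eq_powerSum (x := x) (z := y)]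
  · exact hle
  · rw [mem_cellStar] at hy
    exact fun i => Or.inl (congrFun hy i)

/-- The outcome `x'` of a step from `x` that does not stop. -/
structure IsMove (S : SphereArrangement d n) (p x x' : EuclideanSpace ℝ (Fin d)) : Prop where
  step_eq : S.step x = (x', false)
  cost_le : S.cost x' ≤ S.cost x
  signs_ne : x' ≠ p → S.signs x' ≠ S.signsStar x
  isFace : x' ≠ p → IsFace (S.signs x') (S.signsStar x)
  signsStar_ne : x' ≠ p → S.signsStar x' ≠ S.signsStar x
  eq : S.signsStar x = S.signs p → x' = p

/-- Common core of the line and sphere procedures. The set `T` of exit times is abstract because the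
first procedure does not bound the parameter by 1 and the second does. -/
theorem isMove_of_isDescent (h : S.IsLocalModel p δ) (hx : S.cost x < S.cost p + δ)
    (hxp : x ≠ p) {γ : ℝ → EuclideanSpace ℝ (Fin d)} (hγ : S.IsDescent x γ)
    (h1 : γ 1 ∉ S.cellStar x) {T : Set ℝ} (hT : ∀ t ∈ T, 0 < t)
    (hT' : ∀ t ∈ Set.Icc (0 : ℝ) 1, t ∈ T ↔ 0 < t ∧ γ t ∉ S.cellStar x)
    (hstep : S.step x = (γ (sInf T), false)) (hne : S.signsStar x ≠ S.signs p) :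
    IsMove S p x (γ (sInf T)) := by
  obtain ⟨h0, hle, hout, hIoo⟩ := hγ.exit (h.nondeg x hx) (h.genGrad_ne_zero hxp) h1 hT hT'
  have hface := hγ.isFace_exit h0 hle hIoo
  have hcost : S.cost (γ (sInf T)) ≤ S.cost x := by
    rw [cost_eq_powerSum hface, cost_eq_powerSum (isFace_signs_signsStar x)]
    exact hγ.le _ ⟨h0.le, hle⟩
  exact ⟨hstep, hcost, fun _ he => hout (mem_cellStar.2 he), fun _ => hface, fun hp =>
    hγ.signsStar_exit_ne h0 hle hIoo hout (h.nondeg _ (hcost.trans_lt hx))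
      (h.genGrad_ne_zero hp), fun he => absurd he hne⟩

theorem exists_isMove_of_eq_empty (h : S.IsLocalModel p δ) (hp : (S.Izero p).Nonempty)
    (hx : S.cost x < S.cost p + δ) (hxp : x ≠ p) (h0 : S.IzeroStar x = ∅) :
    ∃ x', IsMove S p x x' := by
  -- The cell being entered is open, whereas `p` lies on a sphere. Hence the centroid cannot lie in
  -- that cell, as it would be `p`, and the step never stops here.
  have hne : S.signsStar x ≠ S.signs p := by
    intro he
    obtain ⟨i, hi⟩ := hp
    have h1 := congrFun he i
    rw [signs_eq_zero.2 (mem_Izero.1 hi), signsStar_eq_zero, h0] at h1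
    simp at h1
  have hc : S.centroid (S.IposStar x) ∉ S.cellStar x := by
    intro hc
    have hP := IposStar_nonempty (h.nonempty x)
    have := h.eq_of_mem_cellStar hx hc (by
      rw [powerSum_eq_centroid _ hP p]
      have : 0 ≤ ((S.IposStar x).card : ℝ) * ‖p - S.centroid (S.IposStar x)‖ ^ 2 := by positivity
      linarith)
    rw [this, mem_cellStar] at hc
    exact hne hc.symm
  refine ⟨_, h.isMove_of_isDescent hx hxp (isDescent_line (h.nonempty x) h0) (by simpa using hc)
    (T := {t : ℝ | 0 < t ∧ x + t • (S.centroid (S.IposStar x) - x) ∉ S.cellStar x})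
    (fun t ht => ht.1) (fun t _ => Iff.rfl) ?_ hne⟩
  by_cases hz : S.Izero x = ∅
  · have hP : S.IposStar x = S.Ipos x := by simp [IposStar, hz]
    rw [hP] at hc ⊢
    simp only [step, hz, if_true]
    rw [← hz, cell_eq_cellStar hz, if_neg hc, lineExit]
  · simp only [step, if_neg hz, if_neg (h.genGrad_ne_zero hxp), if_pos h0, if_neg hc, lineExit]

theorem exists_isMove_of_ne_empty (h : S.IsLocalModel p δ)
    (hx : S.cost x < S.cost p + δ) (hxp : x ≠ p) (h0 : S.IzeroStar x ≠ ∅) :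
    ∃ x', IsMove S p x x' := by
  have hJ : (S.IzeroStar x).Nonempty := Finset.nonempty_iff_ne_empty.2 h0
  have hz : S.Izero x ≠ ∅ := by
    obtain ⟨i, hi⟩ := hJ
    exact Finset.ne_empty_of_mem (Finset.mem_filter.1 hi).1
  have hxS : x ∈ S.sphereInter (S.IzeroStar x) := fun i hi =>
    mem_Izero.1 (Finset.mem_filter.1 hi).1
  have hcR := isCenterRadius_interCenterRadius hJ hxS
  have hR := hcR.pos h.transverse hxS
  have hμ : S.IsMultiplier x x (S.weight x) := isMultiplier_weight rfl
  have hy : S.minOnInter (S.IposStar x) (S.IzeroStar x) ∈ S.sphereInter (S.IzeroStar x) ∧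
      ∀ z ∈ S.sphereInter (S.IzeroStar x),
        S.powerSum (S.IposStar x) (S.minOnInter (S.IposStar x) (S.IzeroStar x)) ≤
          S.powerSum (S.IposStar x) z :=
    Classical.epsilon_spec (p := fun y : EuclideanSpace ℝ (Fin d) =>
      y ∈ S.sphereInter (S.IzeroStar x) ∧ ∀ z ∈ S.sphereInter (S.IzeroStar x),
        S.powerSum (S.IposStar x) y ≤ S.powerSum (S.IposStar x) z)
      (hμ.exists_isMinOn (h.nonempty x) hcR hR hxS)
  have hpS := h.mem_sphereInter hx
  by_cases hyC : S.minOnInter (S.IposStar x) (S.IzeroStar x) ∈ S.cellStar x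
  · have hyp := h.eq_of_mem_cellStar hx hyC (hy.2 p hpS)
    refine ⟨p, ?_, h.isMin x, fun hne => absurd rfl hne, fun hne => absurd rfl hne,
      fun hne => absurd rfl hne, fun _ => rfl⟩
    simp only [step, if_neg hz, if_neg (h.genGrad_ne_zero hxp), if_neg h0, if_pos hyC, hyp]
  · have hone := geodesic_one _ hR (hcR.norm_sub hy.1) x
    refine ⟨_, h.isMove_of_isDescent hx hxp
      (isDescent_geodesic (h.nonempty x) hμ hcR hR hxS hy.1 hy.2) (by rwa [hone])
      (T := {t : ℝ | 0 < t ∧ t ≤ 1 ∧ geodesic (S.interCenterRadius (S.IzeroStar x)).1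
        (S.interCenterRadius (S.IzeroStar x)).2 x
        (S.minOnInter (S.IposStar x) (S.IzeroStar x)) t ∉ S.cellStar x})
      (fun t ht => ht.1) (fun t ht => ?_) ?_ fun he => hyC ?_⟩
    · exact ⟨fun h1 => ⟨h1.1, h1.2.2⟩, fun h1 => ⟨h1.1, ht.2, h1.2⟩⟩
    · simp only [step, if_neg hz, if_neg (h.genGrad_ne_zero hxp), if_neg h0, if_neg hyC,
        geodesicExit]
    -- If the cell entered is that of `p`, then `weight p` is a multiplier at `p` with zero
    -- combination. The pole formula seen from `p` makes `y - c` a positive multiple of `p - c` of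
    -- the same norm, so `y = p`, which lies in the cell.
    · have hμp : S.IsMultiplier x p (S.weight p) :=
        isMultiplier_weight (h.signsStar_self.trans he.symm)
      obtain ⟨κ, m, hκ, hm, hyc, -⟩ := hμp.sub_center_eq (h.nonempty x) hcR hR hpS hy.1 hy.2
      rw [← genGrad_eq_comb, h.genGrad_eq_zero, sub_zero, smul_smul] at hyc
      have hn := hcR.norm_sub hy.1
      rw [hyc, norm_smul, hcR.norm_sub hpS, Real.norm_of_nonneg (by positivity)] at hn
      have hκm : κ * m = 1 := mul_right_cancel₀ hR.ne' (by rw [hn, one_mul])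
      rw [hκm, one_smul, sub_left_inj] at hyc
      rw [hyc, mem_cellStar, he]

theorem exists_isMove (h : S.IsLocalModel p δ) (hp : (S.Izero p).Nonempty)
    (hx : S.cost x < S.cost p + δ) (hxp : x ≠ p) : ∃ x', IsMove S p x x' := by
  by_cases h0 : S.IzeroStar x = ∅
  · exact h.exists_isMove_of_eq_empty hp hx hxp h0
  · exact h.exists_isMove_of_ne_empty hx hxp h0

theorem step_self (h : S.IsLocalModel p δ) (hp : (S.Izero p).Nonempty) :
    S.step p = (p, true) := by
  simp only [step, if_neg hp.ne_empty, if_pos h.genGrad_eq_zero]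

end IsLocalModel

/-! ### Local structure of the arrangement -/

/-- A neighborhood `W` of `p` on which the quadratic program is non-degenerate and in which every
cell adjacent to `p` has a point that can be approached from all the cells around it. -/
structure IsChart (S : SphereArrangement d n) (p : EuclideanSpace ℝ (Fin d))
    (W : Set (EuclideanSpace ℝ (Fin d))) : Prop where
  mem_nhds : W ∈ 𝓝 p
  nondeg : ∀ x ∈ W, S.QPNondegenerate x
  signs_eq : ∀ x ∈ W, ∀ i, S.signs p i ≠ 0 → S.signs x i = S.signs p i
  approach : ∀ τ : Fin n → SignType, (∀ i, S.signs p i ≠ 0 → τ i = S.signs p i) →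
    ∃ z ∈ W, S.signs z = τ ∧ ∀ x ∈ W, IsFace τ (S.signs x) →
      ∃ A ⊆ W, IsPreconnected A ∧ x ∈ A ∧ z ∈ closure A ∧ ∀ y ∈ A, S.signs y = S.signs x

theorem eventually_signs_eq (p : EuclideanSpace ℝ (Fin d)) :
    ∀ᶠ x in 𝓝 p, ∀ i, S.signs p i ≠ 0 → S.signs x i = S.signs p i := by
  refine eventually_all.2 fun i => ?_
  have hc := (continuous_power (S := S) i).continuousAt (x := p)
  rcases lt_trichotomy (S.power i p) 0 with h | h | h
  · filter_upwards [hc.eventually (eventually_lt_nhds h)] with x hx _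
    rw [signs_eq_neg_one.2 h, signs_eq_neg_one.2 hx]
  · exact Eventually.of_forall fun x hx => absurd (signs_eq_zero.2 h) hx
  · filter_upwards [hc.eventually (eventually_gt_nhds h)] with x hx _
    rw [signs_eq_one.2 h, signs_eq_one.2 hx]

/-- Choose `e` having inner product 1 with every active gradient at `p`. Then `fᵢ(p + u) = ⟨∇fᵢ(p),
u + ‖u‖² e⟩`, so the coordinate change `Ψ` turns all spheres through `p` into hyperplanes through 0
at once. Cells become cones cut by a ball, where points of faces are joined to points of cells by
segments. -/
theorem exists_isChart (hT : S.Transverse) {p : EuclideanSpace ℝ (Fin d)}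
    (hnd : ∀ᶠ x in 𝓝 p, S.QPNondegenerate x) : ∃ W, S.IsChart p W := by
  obtain ⟨e, he⟩ := exists_inner_grad_eq hT p 1
  let Ψ : EuclideanSpace ℝ (Fin d) → EuclideanSpace ℝ (Fin d) := fun u => u + ‖u‖ ^ 2 • e
  have hΨ0 : Ψ 0 = 0 := by simp [Ψ]
  have hder : HasStrictFDerivAt Ψ
      ((ContinuousLinearEquiv.refl ℝ (EuclideanSpace ℝ (Fin d)) :
        EuclideanSpace ℝ (Fin d) →L[ℝ] EuclideanSpace ℝ (Fin d))) 0 := by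
    have h := (hasStrictFDerivAt_id (𝕜 := ℝ) (0 : EuclideanSpace ℝ (Fin d))).add
      ((hasStrictFDerivAt_norm_sq (0 : EuclideanSpace ℝ (Fin d))).smul_const e)
    refine h.congr_fderiv ?_
    ext v
    simp
  let Φ := hder.toOpenPartialHomeomorph Ψ
  have hΦ : ∀ u, Φ u = Ψ u := fun u => rfl
  have h0s : (0 : EuclideanSpace ℝ (Fin d)) ∈ Φ.source := hder.mem_toOpenPartialHomeomorph_source
  have h0t : (0 : EuclideanSpace ℝ (Fin d)) ∈ Φ.target := by
    have := Φ.map_source h0s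
    rwa [hΦ, hΨ0] at this
  have hsymm0 : Φ.symm 0 = 0 := by
    have := Φ.left_inv h0s
    rwa [hΦ, hΨ0] at this
  let θ : EuclideanSpace ℝ (Fin d) → EuclideanSpace ℝ (Fin d) := fun w => p + Φ.symm w
  have hθ0 : θ 0 = p := by simp [θ, hsymm0]
  have hθc : ContinuousOn θ Φ.target := continuousOn_const.add Φ.continuousOn_symm
  have hev : ∀ᶠ w in 𝓝 (0 : EuclideanSpace ℝ (Fin d)), w ∈ Φ.target ∧
      S.QPNondegenerate (θ w) ∧ ∀ i, S.signs p i ≠ 0 → S.signs (θ w) i = S.signs p i := by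
    have h1 : Tendsto θ (𝓝 0) (𝓝 p) := by
      have := hθc.continuousAt (Φ.open_target.mem_nhds h0t)
      rwa [ContinuousAt, hθ0] at this
    exact (Φ.open_target.eventually_mem h0t).and (h1.eventually (hnd.and (eventually_signs_eq p)))
  obtain ⟨r, hr, hball⟩ := Metric.eventually_nhds_iff_ball.1 hev
  have hpow : ∀ w ∈ Φ.target, ∀ i, S.power i p = 0 →
      S.power i (θ w) = inner ℝ (S.grad i p) w := by
    intro w hw i hi
    have h1 : Ψ (Φ.symm w) = w := Φ.right_inv hw
    conv_rhs => rw [← h1]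
    rw [power_add, hi, inner_add_right, real_inner_smul_right, he i hi, Pi.one_apply]
    ring
  have hθW : ∀ x, x - p ∈ Φ.source → θ (Ψ (x - p)) = x := by
    intro x hx
    have := Φ.left_inv hx
    rw [hΦ] at this
    simp [θ, this]
  have hθs : ∀ w ∈ Metric.ball (0 : EuclideanSpace ℝ (Fin d)) r,
      θ w - p ∈ Φ.source ∧ Ψ (θ w - p) = w := by
    intro w hw
    have hwt := (hball w hw).1
    simp only [θ, add_sub_cancel_left]
    exact ⟨Φ.map_target hwt, Φ.right_inv hwt⟩
  refine ⟨{x | x - p ∈ Φ.source ∧ Ψ (x - p) ∈ Metric.ball 0 r}, ?_, ?_, ?_, ?_⟩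
  · have hc1 : Continuous fun x : EuclideanSpace ℝ (Fin d) => x - p := by fun_prop
    have hc2 : Continuous fun x : EuclideanSpace ℝ (Fin d) => Ψ (x - p) := by
      simp only [Ψ]
      fun_prop
    refine (hc1.continuousAt.eventually_mem ?_).and (hc2.continuousAt.eventually_mem ?_)
    · rw [sub_self]
      exact Φ.open_source.mem_nhds h0s
    · rw [sub_self, hΨ0]
      exact Metric.ball_mem_nhds 0 hr
  · rintro x ⟨hx1, hx2⟩
    rw [← hθW x hx1]
    exact (hball _ hx2).2.1
  · rintro x ⟨hx1, hx2⟩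
    rw [← hθW x hx1]
    exact (hball _ hx2).2.2
  · intro τ hτ
    obtain ⟨v, hv⟩ := exists_inner_grad_eq hT p fun i => (τ i : ℝ)
    obtain ⟨ε, hε, hεv⟩ : ∃ ε : ℝ, 0 < ε ∧ ‖ε • v‖ < r := by
      have h1 : ∀ᶠ ε : ℝ in 𝓝[>] 0, ‖ε • v‖ < r := by
        apply Filter.Eventually.filter_mono nhdsWithin_le_nhds
        exact ContinuousAt.eventually_lt (by fun_prop) continuousAt_const (by simpa using hr)
      obtain ⟨ε, h2, h3⟩ := (h1.and self_mem_nhdsWithin).exists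
      exact ⟨ε, h3, h2⟩
    have hw1 : ε • v ∈ Metric.ball (0 : EuclideanSpace ℝ (Fin d)) r := by
      rwa [mem_ball_zero_iff]
    have hsign1 : ∀ i, S.power i p = 0 → S.power i (θ (ε • v)) = ε * (τ i : ℝ) := by
      intro i hi
      rw [hpow _ (hball _ hw1).1 i hi, real_inner_smul_right, hv i hi]
    refine ⟨θ (ε • v), ⟨(hθs _ hw1).1, by rwa [(hθs _ hw1).2]⟩, ?_, ?_⟩
    · funext i
      by_cases hi : S.signs p i = 0
      · rw [signs, hsign1 i (signs_eq_zero.1 hi), sign_mul, sign_pos hε, one_mul]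
        rcases signType_cases (τ i) with h | h | h <;> simp [h]
      · rw [(hball _ hw1).2.2 i hi, hτ i hi]
    · rintro x ⟨hx1, hx2⟩ hface
      have hseg : ∀ t ∈ Set.Icc (0 : ℝ) 1,
          (1 - t) • (ε • v) + t • Ψ (x - p) ∈ Metric.ball (0 : EuclideanSpace ℝ (Fin d)) r :=
        fun t ht => convex_ball 0 r hw1 hx2 (sub_nonneg.2 ht.2) ht.1 (by ring)
      have hcont : ContinuousOn (fun t : ℝ => θ ((1 - t) • (ε • v) + t • Ψ (x - p)))
          (Set.Icc 0 1) :=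
        hθc.comp (by fun_prop) fun t ht => (hball _ (hseg t ht)).1
      -- The parameter 0 gives `z`, which may have more vanishing powers than `x`; it is only
      -- required in the closure.
      refine ⟨(fun t : ℝ => θ ((1 - t) • (ε • v) + t • Ψ (x - p))) '' Set.Ioc 0 1, ?_,
        isPreconnected_Ioc.image _ (hcont.mono Set.Ioc_subset_Icc_self),
        ⟨1, ⟨zero_lt_one, le_rfl⟩, ?_⟩, ?_, ?_⟩
      · rintro _ ⟨t, ht, rfl⟩
        have h1 := hseg t ⟨ht.1.le, ht.2⟩
        exact ⟨(hθs _ h1).1, by rw [(hθs _ h1).2]; exact h1⟩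
      · simp only [sub_self, zero_smul, one_smul, zero_add]
        exact hθW x hx1
      · have h1 := ((hcont 0 ⟨le_rfl, zero_le_one⟩).mono
          Set.Ioc_subset_Icc_self).mem_closure_image (by
            rw [closure_Ioc zero_ne_one]
            exact ⟨le_rfl, zero_le_one⟩)
        simpa using h1
      · rintro _ ⟨t, ht, rfl⟩
        have hb := hseg t ⟨ht.1.le, ht.2⟩
        funext i
        by_cases hi : S.signs p i = 0
        · have hi' := signs_eq_zero.1 hi
          have hval : S.power i (θ ((1 - t) • (ε • v) + t • Ψ (x - p))) =
              (1 - t) * (ε * (τ i : ℝ)) + t * S.power i x := by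
            rw [hpow _ (hball _ hb).1 i hi', inner_add_right, real_inner_smul_right,
              real_inner_smul_right, real_inner_smul_right, hv i hi',
              ← hpow _ (hball _ hx2).1 i hi', hθW x hx1]
          by_cases hx0 : S.signs x i = 0
          · have hτ0 : τ i = 0 := by
              rcases hface i with h | h
              · rw [h, hx0]
              · exact h
            rw [hx0, signs_eq_zero, hval, hτ0, signs_eq_zero.1 hx0]
            simp
          · refine (sign_eq_iff_mul_pos hx0).2 ?_
            have h1 : 0 < (S.signs x i : ℝ) * S.power i x := (sign_eq_iff_mul_pos hx0).1 rfl
            have h2 : 0 ≤ (S.signs x i : ℝ) * (τ i : ℝ) := by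
              rcases hface i with h | h
              · rw [h]
                exact mul_self_nonneg _
              · simp [h]
            rw [hval]
            have h3 : 0 ≤ (1 - t) * ε * ((S.signs x i : ℝ) * (τ i : ℝ)) :=
              mul_nonneg (mul_nonneg (sub_nonneg.2 ht.2) hε.le) h2
            have h4 := mul_pos ht.1 h1
            linarith
        · rw [(hball _ hb).2.2 i hi, ← hθW x hx1, (hball _ hx2).2.2 i hi]

/-- Each of the finitely many other patterns defines a closed set of solvable points that does not
contain `p`. -/
theorem eventually_signsStar_eq (hT : S.Transverse) {p : EuclideanSpace ℝ (Fin d)}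
    (hp : S.QPNondegenerate p) (hs : S.signsStar p = S.signs p) :
    ∀ᶠ x in 𝓝 p, S.signs x = S.signs p → S.signsStar x = S.signs p := by
  have h1 : ∀ᶠ x in 𝓝 p, ∀ t : Fin n → SignType, t ≠ S.signs p →
      (∀ i, S.signs p i ≠ 0 → t i = S.signs p i) → ¬ ∃ μ, S.IsKKT x (S.signs p) t μ := by
    refine eventually_all.2 fun t => ?_
    by_cases ht : t ≠ S.signs p ∧ ∀ i, S.signs p i ≠ 0 → t i = S.signs p i
    · have h2 := (isClosed_setOf_isKKT (S := S) (S.signs p) t).isOpen_compl.mem_nhds (x := p)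
        (by
          rintro ⟨μ, hμ⟩
          exact ht.1 ((signsStar_eq_of_isKKT hT hp hμ ht.2).symm.trans hs))
      filter_upwards [h2] with x hx _ _
      exact hx
    · exact Eventually.of_forall fun x h3 h4 => absurd ⟨h3, h4⟩ ht
  filter_upwards [h1] with x hx hsx
  by_contra hne
  refine hx _ hne (fun i hi => ?_) ⟨S.weight x, ?_⟩
  · rw [← hsx] at hi ⊢
    exact signsStar_eq_signs hi
  · rw [← hsx]
    exact isKKT_weight x

/-- The cost exceeds its minimum by at least `‖x - p‖²`, so the sublevel set of height `r²` fits in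
the ball of radius `r`. -/
theorem exists_isLocalModel (hT : S.Transverse) (hpos : ∀ x, (S.Ipos x).Nonempty)
    {p : EuclideanSpace ℝ (Fin d)} (hmin : ∀ y, S.cost p ≤ S.cost y)
    {W : Set (EuclideanSpace ℝ (Fin d))} (hW : S.IsChart p W) :
    ∃ δ, S.IsLocalModel p δ ∧ ∀ x, S.cost x < S.cost p + δ → x ∈ W := by
  have h0 := genGrad_eq_zero_of_isMin hmin
  have hp := hW.nondeg p (mem_of_mem_nhds hW.mem_nhds)
  have hs := signsStar_eq_signs_of_genGrad_eq_zero h0 hp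
  obtain ⟨r, hr, hball⟩ := Metric.mem_nhds_iff.1
    (Filter.inter_mem hW.mem_nhds (eventually_signsStar_eq hT hp hs))
  have hsub : ∀ x, S.cost x < S.cost p + r ^ 2 → x ∈ Metric.ball p r := by
    intro x hx
    have := cost_ge_of_genGrad_eq_zero (hpos p) h0 x
    rw [mem_ball_iff_norm]
    exact lt_of_pow_lt_pow_left₀ 2 hr.le (by linarith)
  exact ⟨r ^ 2, ⟨hT, hpos, hmin, by positivity, fun x hx => hW.nondeg x (hball (hsub x hx)).1,
    fun x hx => hW.signs_eq x (hball (hsub x hx)).1, fun x hx => (hball (hsub x hx)).2⟩,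
    fun x hx => (hball (hsub x hx)).1⟩

/-! ### Cells are not revisited -/

theorem IsKKT.congr_of_signs_ne_zero {x z : EuclideanSpace ℝ (Fin d)}
    {s t t' : Fin n → SignType} {s' : Fin n → SignType} {μ ν : Fin n → ℝ}
    (hμ : S.IsKKT x s t μ) (hν : S.IsKKT z s' t' ν) {i : Fin n} (ht : t i ≠ 0)
    (h : t i = t' i) : μ i = ν i := by
  rcases signType_cases (t i) with h1 | h1 | h1
  · rw [hμ.one i h1, hν.one i (h ▸ h1)]
  · exact absurd h1 ht
  · rw [hμ.zero i h1, hν.zero i (h ▸ h1)]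

/-- The norms of the solutions of the optimality conditions decrease along moves. -/
theorem IsKKT.norm_sq_add_le {z : EuclideanSpace ℝ (Fin d)} {s s' t t' : Fin n → SignType}
    {μ ν : Fin n → ℝ} (hμ : S.IsKKT z s t μ) (hν : S.IsKKT z s' t' ν) (hface : IsFace s' t)
    (hface' : IsFace s' t') :
    ‖S.comb ν z‖ ^ 2 + ‖S.comb μ z - S.comb ν z‖ ^ 2 ≤ ‖S.comb μ z‖ ^ 2 := by
  have h1 := hν.inner_sub_nonneg hμ.mem fun i hi => by
    have h2 := (hface i).resolve_right hi
    have h3 := (hface' i).resolve_right hi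
    exact hμ.congr_of_signs_ne_zero hν (h2 ▸ hi) (h2.symm.trans h3)
  have h2 : S.comb μ z = S.comb ν z + (S.comb μ z - S.comb ν z) := by abel
  have h3 := norm_add_sq_real (S.comb ν z) (S.comb μ z - S.comb ν z)
  rw [← h2] at h3
  linarith

/-- Both sides are the projection of one vector to one subspace: the multipliers differ only where
`t` is zero, and both combinations are orthogonal to those gradients, so the difference is
orthogonal to itself. -/
theorem IsKKT.comb_eq {z : EuclideanSpace ℝ (Fin d)} {s s' t : Fin n → SignType}
    {μ ν : Fin n → ℝ} (hμ : S.IsKKT z s t μ) (hν : S.IsKKT z s' t ν)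
    (hs : ∀ i, t i = 0 → s i = 0) (hs' : ∀ i, t i = 0 → s' i = 0) :
    S.comb μ z = S.comb ν z := by
  have h0 : S.comb μ z - S.comb ν z = ∑ i, (μ i - ν i) • S.grad i z := by
    simp [comb, sub_smul]
  have h1 : inner ℝ (S.comb μ z - S.comb ν z) (S.comb μ z - S.comb ν z) = 0 := by
    conv_lhs => rw [h0, inner_sum, ← h0]
    refine Finset.sum_eq_zero fun i _ => ?_
    rw [real_inner_smul_right]
    by_cases hi : t i = 0
    · rw [inner_sub_left, hμ.inner_eq i (hs i hi) hi, hν.inner_eq i (hs' i hi) hi]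
      ring
    · rw [hμ.congr_of_signs_ne_zero hν hi rfl, sub_self, zero_mul]
  exact sub_eq_zero.1 (inner_self_eq_zero.1 h1)

/-- A sequence of moves that comes back to the cell it started with stays in that cell. -/
theorem IsChart.signsStar_eq_of_cycle (hT : S.Transverse) {p : EuclideanSpace ℝ (Fin d)}
    {W : Set (EuclideanSpace ℝ (Fin d))} (hW : S.IsChart p W)
    {x : ℕ → EuclideanSpace ℝ (Fin d)} {l : ℕ} (hx : ∀ j ≤ l, x j ∈ W)
    (hface : ∀ j < l, IsFace (S.signs (x (j + 1))) (S.signsStar (x j)))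
    (hcyc : S.signsStar (x l) = S.signsStar (x 0)) :
    ∃ t, ∀ j ≤ l, S.signsStar (x j) = t := by
  classical
  -- The common face of all the cells of the cycle: a sphere that is never touched is never crossed,
  -- so its sign is constant.
  let τ : Fin n → SignType := fun i =>
    if ∃ j ≤ l, S.signs (x j) i = 0 then 0 else S.signs (x 0) i
  have hτface : ∀ j ≤ l, IsFace τ (S.signs (x j)) := by
    intro j hj i
    by_cases h : ∃ j ≤ l, S.signs (x j) i = 0
    · exact Or.inr (if_pos h)
    · left
      simp only [τ, if_neg h]
      push Not at h
      induction j with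
      | zero => rfl
      | succ j ih =>
        rw [ih (by omega), ← signsStar_eq_signs (h j (by omega))]
        exact ((hface j (by omega) i).resolve_right (h _ hj)).symm
  have hτp : ∀ i, S.signs p i ≠ 0 → τ i = S.signs p i := by
    intro i hi
    have h : ¬ ∃ j ≤ l, S.signs (x j) i = 0 := by
      rintro ⟨j, hj, h0⟩
      rw [hW.signs_eq _ (hx j hj) i hi] at h0
      exact hi h0
    simp only [τ, if_neg h]
    exact hW.signs_eq _ (hx 0 (Nat.zero_le _)) i hi
  obtain ⟨z, hzW, hzτ, happ⟩ := hW.approach τ hτp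
  have hKKT : ∀ j, ∃ μ, j ≤ l → S.IsKKT z (S.signs (x j)) (S.signsStar (x j)) μ := by
    intro j
    by_cases hj : j ≤ l
    · obtain ⟨A, hAW, hA, hxA, hzA, hsA⟩ := happ (x j) (hx j hj) (hτface j hj)
      have hsub : A ⊆ {y | ∃ μ, S.IsKKT y (S.signs (x j)) (S.signsStar (x j)) μ} := by
        intro y hy
        refine ⟨S.weight y, ?_⟩
        rw [← signsStar_const hT hA hsA (fun y hy => hW.nondeg y (hAW hy)) hxA hy, ← hsA y hy]
        exact isKKT_weight y
      obtain ⟨μ, hμ⟩ := closure_minimal hsub (isClosed_setOf_isKKT _ _) hzA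
      exact ⟨μ, fun _ => hμ⟩
    · exact ⟨0, fun h => absurd h hj⟩
  choose μ hμ using hKKT
  have hdec : ∀ j, j < l → ‖S.comb (μ (j + 1)) z‖ ^ 2 +
      ‖S.comb (μ j) z - S.comb (μ (j + 1)) z‖ ^ 2 ≤ ‖S.comb (μ j) z‖ ^ 2 := fun j hj =>
    (hμ j hj.le).norm_sq_add_le (hμ (j + 1) hj) (hface j hj) (isFace_signs_signsStar _)
  have hanti : ∀ i j, i ≤ j → j ≤ l → ‖S.comb (μ j) z‖ ^ 2 ≤ ‖S.comb (μ i) z‖ ^ 2 := by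
    intro i j hij
    induction j, hij using Nat.le_induction with
    | base => exact fun _ => le_rfl
    | succ j hij ih =>
      intro hj
      have h1 := ih (by omega)
      have h2 := hdec j (by omega)
      linarith [sq_nonneg ‖S.comb (μ j) z - S.comb (μ (j + 1)) z‖]
  have hends : S.comb (μ 0) z = S.comb (μ l) z := by
    have h0 := hμ 0 (Nat.zero_le _)
    have hl := hμ l le_rfl
    rw [hcyc] at hl
    refine h0.comb_eq hl (fun i hi => signs_eq_zero_of_signsStar hi) fun i hi => ?_
    exact signs_eq_zero_of_signsStar (x := x l) (by rw [hcyc, hi])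
  have hcomb : ∀ j ≤ l, S.comb (μ j) z = S.comb (μ 0) z := by
    intro j
    induction j with
    | zero => exact fun _ => rfl
    | succ j ih =>
      intro hj
      rw [← ih (by omega)]
      have h1 := hdec j (by omega)
      have h2 := hanti (j + 1) l hj le_rfl
      have h3 := hanti 0 j (Nat.zero_le _) (by omega)
      rw [← hends] at h2
      have h4 : ‖S.comb (μ j) z - S.comb (μ (j + 1)) z‖ = 0 := by
        nlinarith [norm_nonneg (S.comb (μ j) z - S.comb (μ (j + 1)) z)]
      exact (sub_eq_zero.1 (norm_eq_zero.1 h4)).symm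
  have hstar : ∀ j ≤ l, ∀ i, τ i ≠ 0 → S.signsStar (x j) i = τ i := by
    intro j hj i hi
    have h1 := (hτface j hj i).resolve_right hi
    rw [h1] at hi ⊢
    exact signsStar_eq_signs hi
  have hμeq : ∀ j ≤ l, μ j = μ 0 := by
    intro j hj
    refine eq_of_comb_eq hT (hcomb j hj) fun i hi => ?_
    rw [hzτ] at hi
    have h1 := hstar j hj i hi
    have h2 := hstar 0 (Nat.zero_le _) i hi
    exact (hμ j hj).congr_of_signs_ne_zero (hμ 0 (Nat.zero_le _)) (h1 ▸ hi) (h1.trans h2.symm)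
  have hμ0 : ∀ j ≤ l, S.IsKKT z (S.signs (x j)) (S.signsStar (x j)) (μ 0) := fun j hj =>
    hμeq j hj ▸ hμ j hj
  have hzero : ∀ i, τ i = 0 → ∃ j ≤ l, S.signs (x j) i = 0 := by
    intro i hi
    by_contra h
    have h1 : τ i = S.signs (x 0) i := if_neg h
    exact h ⟨0, Nat.zero_le _, h1 ▸ hi⟩
  -- The pattern read off from the common multipliers. They solve the full program at `z`, because
  -- each sphere through `z` was touched at some time of the cycle, and that time supplies its
  -- optimality condition.
  let t : Fin n → SignType := fun i => if μ 0 i = 1 then 1 else if μ 0 i = 0 then -1 else 0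
  have ht1 : ∀ i, t i = 1 ↔ μ 0 i = 1 := by
    intro i
    simp only [t]
    split_ifs <;> simp_all
  have ht2 : ∀ i, t i = -1 ↔ μ 0 i = 0 := by
    intro i
    simp only [t]
    split_ifs <;> simp_all
  have hcases : ∀ j ≤ l, ∀ i, S.signsStar (x j) i ≠ 0 → t i = S.signsStar (x j) i := by
    intro j hj i hi
    rcases signType_cases (S.signsStar (x j) i) with h | h | h
    · rw [h, ht1, (hμ0 j hj).one i h]
    · exact absurd h hi
    · rw [h, ht2, (hμ0 j hj).zero i h]
  have htz : S.IsKKT z (S.signs z) t (μ 0) := by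
    rw [hzτ]
    refine ⟨(hμ0 0 (Nat.zero_le _)).mem, fun i => (ht1 i).1, fun i => (ht2 i).1, ?_, ?_, ?_⟩ <;>
      intro i hi hti <;> obtain ⟨j, hj, hs⟩ := hzero i hi <;>
      by_cases h0 : S.signsStar (x j) i = 0
    · exact (hμ0 j hj).inner_eq i hs h0
    · exact absurd ((hcases j hj i h0).symm.trans hti) h0
    · exact ((hμ0 j hj).inner_eq i hs h0).le
    · exact (hμ0 j hj).inner_nonpos i hs ((hcases j hj i h0).symm.trans hti)
    · exact ((hμ0 j hj).inner_eq i hs h0).ge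
    · exact (hμ0 j hj).inner_nonneg i hs ((hcases j hj i h0).symm.trans hti)
  have htτ : ∀ i, τ i ≠ 0 → t i = τ i := by
    intro i hi
    have h1 := hstar 0 (Nat.zero_le _) i hi
    rw [← h1]
    exact hcases 0 (Nat.zero_le _) i (h1 ▸ hi)
  have htz' : ∀ i, S.signs z i ≠ 0 → t i = S.signs z i := by
    rw [hzτ]
    exact htτ
  have hst := signsStar_eq_of_isKKT hT (hW.nondeg z hzW) htz htz'
  have hw : μ 0 = S.weight z := htz.unique hT (isKKT_weight z) fun i hi =>
    htz.weight_eq_of_signs_ne_zero htz' hi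
  refine ⟨t, fun j hj => ?_⟩
  funext i
  by_cases h0 : S.signsStar (x j) i = 0
  · rw [h0]
    by_contra hne
    have hsj := signs_eq_zero_of_signsStar h0
    have hz0 : S.signs z i = 0 := by
      rw [hzτ]
      rcases hτface j hj i with h | h
      · rw [h, hsj]
      · exact h
    have h2 := (hμ0 j hj).inner_eq i hsj h0
    rw [hw, ← genGrad_eq_comb, ← (hW.nondeg z hzW).signsStar_eq_zero hz0, hst] at h2
    exact hne h2.symm
  · exact (hcases j hj i h0).symm

/-! ### Convergence -/

theorem run_eq_iterate {x₀ : EuclideanSpace ℝ (Fin d)} {K : ℕ} {x : ℕ → EuclideanSpace ℝ (Fin d)}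
    (h0 : x 0 = x₀) (hstep : ∀ k < K, S.step (x k) = (x (k + 1), false)) :
    ∀ k ≤ K, S.run x₀ k = (x k, false) := by
  intro k
  induction k with
  | zero => exact fun _ => by rw [run, h0]
  | succ k ih =>
    intro hk
    rw [run, ih (by omega)]
    simpa using hstep k (by omega)

/-- Otherwise `3 ^ c` points differ from `p` and enter distinct cells, so every cell adjacent to `p`
is entered. Consider the two cells that differ from that of `p` only in the sign of one sphere `i₀`.
Their only other face near `p` is the cell of `p`, from which the following move ends at `p`; hence
the first of them to be entered is too close to the end of the run for the second to follow. -/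
theorem exists_eq_of_isLocalModel {p : EuclideanSpace ℝ (Fin d)} {δ : ℝ}
    {W : Set (EuclideanSpace ℝ (Fin d))} (h : S.IsLocalModel p δ) (hW : S.IsChart p W)
    (hδW : ∀ x, S.cost x < S.cost p + δ → x ∈ W) (hp : (S.Izero p).Nonempty)
    {x : ℕ → EuclideanSpace ℝ (Fin d)} (hx : ∀ k, S.cost (x k) < S.cost p + δ)
    (hmove : ∀ k, x k ≠ p → IsLocalModel.IsMove S p (x k) (x (k + 1))) :
    ∃ k < 3 ^ (S.Izero p).card, x k = p := by
  classical
  by_contra! hne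
  set K := 3 ^ (S.Izero p).card with hK
  have hoff : ∀ k, ∀ i, S.signs p i ≠ 0 → S.signsStar (x k) i = S.signs p i := by
    intro k i hi
    have h1 := h.signs_eq _ (hx k) i hi
    rw [← h1]
    exact signsStar_eq_signs (by rwa [h1])
  have hinj' : ∀ j k, j < k → k < K → S.signsStar (x j) ≠ S.signsStar (x k) := by
    intro j k hjk hkK he
    obtain ⟨l, rfl⟩ := Nat.exists_eq_add_of_lt hjk
    obtain ⟨t, ht⟩ := hW.signsStar_eq_of_cycle h.transverse (x := fun a => x (j + a))
      (l := l + 1) (fun a _ => hδW _ (hx _))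
      (fun a ha => (hmove (j + a) (hne (j + a) (by omega))).isFace
        (hne (j + (a + 1)) (by omega))) he.symm
    have h0 := ht 0 (by omega)
    have h1 := ht 1 (by omega)
    exact (hmove j (hne j (by omega))).signsStar_ne (hne _ (by omega)) (h1.trans h0.symm)
  let f : Fin K → (S.Izero p → SignType) := fun k i => S.signsStar (x k) i
  have hfeq : ∀ (k : Fin K) (t : Fin n → SignType), (∀ i, S.signs p i ≠ 0 → t i = S.signs p i) →
      (f k = fun i : S.Izero p => t i) → S.signsStar (x k) = t := by
    intro k t ht hk
    funext i
    by_cases hi : S.signs p i = 0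
    · exact congrFun hk ⟨i, mem_Izero.2 (signs_eq_zero.1 hi)⟩
    · rw [hoff k i hi, ht i hi]
  have hfinj : Function.Injective f := by
    intro j k hjk
    have he := hfeq j (S.signsStar (x k)) (hoff k) hjk
    by_contra hne'
    rcases lt_or_gt_of_ne (Fin.val_ne_of_ne hne') with hlt | hlt
    · exact hinj' _ _ hlt k.2 he
    · exact hinj' _ _ hlt j.2 he.symm
  have hcard : Fintype.card (Fin K) = Fintype.card (S.Izero p → SignType) := by
    have : Fintype.card SignType = 3 := rfl
    simp [hK, this]
  have hsurj := ((Fintype.bijective_iff_injective_and_card f).2 ⟨hfinj, hcard⟩).2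
  obtain ⟨i₀, hi₀⟩ := hp
  have hi₀' : S.signs p i₀ = 0 := signs_eq_zero.2 (mem_Izero.1 hi₀)
  have hhit : ∀ s : SignType, ∃ k < K, S.signsStar (x k) = Function.update (S.signs p) i₀ s := by
    intro s
    obtain ⟨k, hk⟩ := hsurj fun i => Function.update (S.signs p) i₀ s i
    refine ⟨k, k.2, hfeq k _ (fun i hi => ?_) hk⟩
    exact Function.update_of_ne (by rintro rfl; exact hi hi₀') _ _
  -- After such a cell, index `k + 1` enters the cell of `p` and index `k + 2` is `p` itself, so `k
  -- + 2` must be out of range.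
  have hnext : ∀ s : SignType, ∀ k, k + 1 < K →
      S.signsStar (x k) = Function.update (S.signs p) i₀ s →
      S.signsStar (x (k + 1)) = S.signs p ∧ ¬ k + 2 < K := by
    intro s k hk hs
    have hm := hmove k (hne k (by omega))
    have hface := hm.isFace (hne _ hk)
    have hsne := hm.signs_ne (hne _ hk)
    rw [hs] at hface hsne
    have h1 : S.signs (x (k + 1)) = S.signs p := by
      have hothers : ∀ i, i ≠ i₀ → S.signs (x (k + 1)) i = S.signs p i := by
        intro i hi
        by_cases hz : S.signs p i = 0
        · rcases hface i with h2 | h2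
          · rw [h2, Function.update_of_ne hi]
          · rw [h2, hz]
        · exact h.signs_eq _ (hx _) i hz
      funext i
      by_cases hi : i = i₀
      · subst hi
        rcases hface i with h2 | h2
        · exfalso
          apply hsne
          funext j
          by_cases hj : j = i
          · subst hj; exact h2
          · rw [Function.update_of_ne hj, hothers j hj]
        · rw [h2, hi₀']
      · exact hothers i hi
    have h2 := h.signsStar_eq _ (hx _) h1
    exact ⟨h2, fun h3 => hne _ h3 ((hmove _ (hne _ hk)).eq h2)⟩
  obtain ⟨a, ha, has⟩ := hhit 1
  obtain ⟨b, hb, hbs⟩ := hhit (-1)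
  have hnot : ∀ s s' : SignType, s' ≠ 0 → ∀ a b, a < b → b < K →
      S.signsStar (x a) = Function.update (S.signs p) i₀ s →
      S.signsStar (x b) = Function.update (S.signs p) i₀ s' → False := by
    intro s s' hs' a b hab hb h1 h2
    obtain ⟨h3, h4⟩ := hnext s a (by omega) h1
    have hba : b = a + 1 := by omega
    subst hba
    rw [h3] at h2
    have h5 := congrFun h2 i₀
    rw [Function.update_self, hi₀'] at h5
    exact hs' h5.symm
  rcases lt_trichotomy a b with hab | hab | hab
  · exact hnot _ _ (by decide) a b hab hb has hbs
  · subst hab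
    have h5 := congrFun (has.symm.trans hbs) i₀
    rw [Function.update_self, Function.update_self] at h5
    exact absurd h5 (by decide)
  · exact hnot _ _ (by decide) b a hab ha hbs has

theorem exists_run_eq_of_izero_nonempty (hT : S.Transverse) (hpos : ∀ x, (S.Ipos x).Nonempty)
    {p : EuclideanSpace ℝ (Fin d)} (hmin : ∀ y, S.cost p ≤ S.cost y)
    (hnd : ∀ᶠ x in 𝓝 p, S.QPNondegenerate x) (hp : (S.Izero p).Nonempty) :
    ∃ U ∈ 𝓝 p, ∀ x₀ ∈ U, ∃ N ≤ 3 ^ (S.Izero p).card, S.run x₀ N = (p, true) := by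
  classical
  obtain ⟨W, hW⟩ := exists_isChart hT hnd
  obtain ⟨δ, h, hδW⟩ := exists_isLocalModel hT hpos hmin hW
  refine ⟨{x | S.cost x < S.cost p + δ},
    (isOpen_lt continuous_cost continuous_const).mem_nhds h.cost_self_lt, fun x₀ hx₀ => ?_⟩
  let x : ℕ → EuclideanSpace ℝ (Fin d) := fun k => (fun y => (S.step y).1)^[k] x₀
  have hsucc : ∀ k, x (k + 1) = (S.step (x k)).1 := fun k =>
    Function.iterate_succ_apply' (fun y => (S.step y).1) k x₀
  have hmv : ∀ k, S.cost (x k) < S.cost p + δ → x k ≠ p →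
      IsLocalModel.IsMove S p (x k) (x (k + 1)) := by
    intro k hk hkp
    obtain ⟨x', hx'⟩ := h.exists_isMove hp hk hkp
    have : x (k + 1) = x' := by rw [hsucc, hx'.step_eq]
    rwa [this]
  have hx : ∀ k, S.cost (x k) < S.cost p + δ := by
    intro k
    induction k with
    | zero => exact hx₀
    | succ k ih =>
      by_cases hkp : x k = p
      · rw [hsucc, hkp, h.step_self hp]
        exact h.cost_self_lt
      · exact (hmv k ih hkp).cost_le.trans_lt ih
  have hmove := fun k => hmv k (hx k)
  have hex := exists_eq_of_isLocalModel h hW hδW hp hx hmove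
  have hex' : ∃ k, x k = p := hex.imp fun k hk => hk.2
  obtain ⟨k, hk, hkp⟩ := hex
  have hrun := run_eq_iterate (S := S) (x₀ := x₀) (x := x) (K := Nat.find hex') rfl
    (fun j hj => (hmove j (Nat.find_min hex' hj)).step_eq) _ le_rfl
  -- The extra pass is the one that finds the gradient zero and stops; the strict inequality in `hk`
  -- pays for it.
  refine ⟨Nat.find hex' + 1, (Nat.find_min' hex' hkp).trans_lt hk, ?_⟩
  rw [run, hrun, Nat.find_spec hex']
  simpa using h.step_self hp

/-- Near `p` all signs agree with those at `p`, and the vanishing gradient says that `p` is the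
centroid of the outer centers. The first pass moves there and stops, matching `3 ^ 0 = 1`. -/
theorem exists_run_eq_of_izero_eq_empty (hpos : ∀ x, (S.Ipos x).Nonempty)
    {p : EuclideanSpace ℝ (Fin d)} (hmin : ∀ y, S.cost p ≤ S.cost y) (hp : S.Izero p = ∅) :
    ∃ U ∈ 𝓝 p, ∀ x₀ ∈ U, ∃ N ≤ 3 ^ (S.Izero p).card, S.run x₀ N = (p, true) := by
  refine ⟨_, eventually_signs_eq (S := S) p, fun x₀ hx₀ => ⟨1, by simp [hp], ?_⟩⟩
  have hs : S.signs x₀ = S.signs p := by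
    funext i
    refine hx₀ i fun h0 => ?_
    have : i ∈ S.Izero p := mem_Izero.2 (signs_eq_zero.1 h0)
    simp [hp] at this
  have hpc : p ∈ S.cell (S.Ipos x₀) (S.Izero x₀) (S.Ineg x₀) :=
    (mem_cell_iff (t := S.signs x₀) (fun _ => by rw [signs_eq_one, mem_Ipos])
      (fun _ => by rw [signs_eq_zero, mem_Izero])
      (fun _ => by rw [signs_eq_neg_one, mem_Ineg])).2 hs.symm
  have hz : S.Izero x₀ = ∅ := by rw [← hpc.2.1, hp]
  have hc : S.centroid (S.Ipos x₀) = p := by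
    rw [← hpc.1]
    have h0 := genGrad_eq_zero_of_isMin hmin
    rw [genGrad, clarkeElem, hp, Finset.sum_empty, add_zero, sum_grad _ (hpos p)] at h0
    have hcard : (0 : ℝ) < (S.Ipos p).card := by exact_mod_cast (hpos p).card_pos
    have := (smul_eq_zero.1 h0).resolve_left (by positivity)
    exact (sub_eq_zero.1 this).symm
  have hcell : S.centroid (S.Ipos x₀) ∈ S.cell (S.Ipos x₀) (S.Izero x₀) (S.Ineg x₀) := by
    rwa [hc]
  simp only [run, step, if_pos hz, hc, Bool.false_eq_true, if_false]
  exact if_pos hcell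

end SphereArrangement

/-! ### Sink spheres -/

section SinkSpheres

variable {d n : ℕ} (η : ℝ) (X : Fin n → EuclideanSpace ℝ (Fin d))

theorem norm_sub_sq_sub_eq_mul_power (hn : 2 ≤ n) (hη : 1 - η * n / ((n : ℝ) - 1) ≠ 0) (i : Fin n)
    (c : EuclideanSpace ℝ (Fin d)) :
    ‖X i - c‖ ^ 2 - η / ((n : ℝ) - 1) * ∑ j, ‖X j - c‖ ^ 2 =
      (1 - η * n / ((n : ℝ) - 1)) * (sinkSpheres η X).power i c := by
  have hn1 : (2 : ℝ) ≤ n := by exact_mod_cast hn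
  have hn0 : (n : ℝ) ≠ 0 := by positivity
  have hn2 : (n : ℝ) - 1 ≠ 0 := by linarith
  set q := η * n / ((n : ℝ) - 1) with hq
  have hηq : η / ((n : ℝ) - 1) = q / n := by
    rw [hq]
    field_simp
  have hsum : ∑ j, ‖X j - c‖ ^ 2 = ∑ j, ‖X j‖ ^ 2 - 2 * inner ℝ (∑ j, X j) c + n * ‖c‖ ^ 2 := by
    simp only [norm_sub_sq_real, Finset.sum_add_distrib, Finset.sum_sub_distrib, ← Finset.mul_sum,
      sum_inner, Finset.sum_const, Finset.card_univ, Fintype.card_fin, nsmul_eq_mul]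
  have hin : inner ℝ c ((1 - q)⁻¹ • (X i - q • ((n : ℝ)⁻¹ • ∑ j, X j))) =
      (1 - q)⁻¹ * (inner ℝ (X i) c - q * ((n : ℝ)⁻¹ * inner ℝ (∑ j, X j) c)) := by
    rw [real_inner_smul_right, inner_sub_right, real_inner_smul_right, real_inner_smul_right,
      real_inner_comm, real_inner_comm c (∑ j, X j)]
  simp only [SphereArrangement.power, sinkSpheres]
  rw [← hq, norm_sub_sq_real c, hin, hηq, hsum, norm_sub_sq_real]
  field_simp
  ring

theorem one_sub_mul_div_pos (hn : 2 ≤ n) (hη₁ : η < 1 - 1 / (n : ℝ)) :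
    0 < 1 - η * n / ((n : ℝ) - 1) := by
  have hn1 : (2 : ℝ) ≤ n := by exact_mod_cast hn
  have hn2 : 0 < (n : ℝ) - 1 := by linarith
  rw [sub_pos, div_lt_one hn2]
  have h := mul_lt_mul_of_pos_right hη₁ (show (0 : ℝ) < n by linarith)
  have h2 : (1 - 1 / (n : ℝ)) * n = n - 1 := by field_simp
  linarith

theorem sphericalCost_eq_mul_cost (hn : 2 ≤ n) (hη₁ : η < 1 - 1 / (n : ℝ))
    (c : EuclideanSpace ℝ (Fin d)) :
    sphericalCost η X c = (1 - η * n / ((n : ℝ) - 1)) * (sinkSpheres η X).cost c := by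
  have h := one_sub_mul_div_pos η hn hη₁
  rw [SphereArrangement.cost,
    Finset.mul_sum Finset.univ (fun i => max 0 ((sinkSpheres η X).power i c))]
  refine Finset.sum_congr rfl fun i _ => ?_
  rw [norm_sub_sq_sub_eq_mul_power η X hn h.ne', mul_max_of_nonneg _ _ h.le, mul_zero]

/-- The untruncated summands add up to `(1 - η') ∑ ‖xⱼ - c‖²`. If none is positive, all data points
equal `c`; then every sink sphere degenerates to the point `c`, where its gradient vanishes, against
transversality. -/
theorem Ipos_sinkSpheres_nonempty (hn : 2 ≤ n) (hη₁ : η < 1 - 1 / (n : ℝ))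
    (htrans : (sinkSpheres η X).Transverse) (c : EuclideanSpace ℝ (Fin d)) :
    ((sinkSpheres η X).Ipos c).Nonempty := by
  by_contra hne
  have h := one_sub_mul_div_pos η hn hη₁
  have hn1 : (2 : ℝ) ≤ n := by exact_mod_cast hn
  have hn2 : (n : ℝ) - 1 ≠ 0 := by linarith
  have hpow : ∀ i, (sinkSpheres η X).power i c ≤ 0 := by
    intro i
    by_contra hi
    exact hne ⟨i, SphereArrangement.mem_Ipos.2 (not_le.1 hi)⟩
  have hsum : (1 - η * n / ((n : ℝ) - 1)) * ∑ j, ‖X j - c‖ ^ 2 =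
      ∑ i, (1 - η * n / ((n : ℝ) - 1)) * (sinkSpheres η X).power i c := by
    simp only [← norm_sub_sq_sub_eq_mul_power η X hn h.ne', Finset.sum_sub_distrib,
      Finset.sum_const, Finset.card_univ, Fintype.card_fin, nsmul_eq_mul]
    ring
  have hle : ∑ j, ‖X j - c‖ ^ 2 ≤ 0 := by
    have h1 : ∑ i, (1 - η * n / ((n : ℝ) - 1)) * (sinkSpheres η X).power i c ≤ 0 :=
      Finset.sum_nonpos fun i _ => mul_nonpos_of_nonneg_of_nonpos h.le (hpow i)
    rw [← hsum] at h1
    by_contra hlt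
    have := mul_pos h (not_le.1 hlt)
    linarith
  have hX : ∀ j, X j = c := by
    have h0 := le_antisymm hle (Finset.sum_nonneg fun j _ => sq_nonneg ‖X j - c‖)
    intro j
    have h1 := (Finset.sum_eq_zero_iff_of_nonneg fun j _ => sq_nonneg ‖X j - c‖).1 h0 j
      (Finset.mem_univ j)
    exact sub_eq_zero.1 (norm_eq_zero.1 (pow_eq_zero_iff two_ne_zero |>.1 h1))
  let i : Fin n := ⟨0, by omega⟩
  have hpi : (sinkSpheres η X).power i c = 0 := by
    have h1 := norm_sub_sq_sub_eq_mul_power η X hn h.ne' i c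
    simp only [hX, sub_self, norm_zero] at h1
    norm_num at h1
    exact h1.resolve_left h.ne'
  have hcenter : (sinkSpheres η X).center i = c := by
    have hn0 : (n : ℝ) ≠ 0 := by positivity
    simp only [sinkSpheres, hX, Finset.sum_const, Finset.card_univ, Fintype.card_fin]
    rw [← Nat.cast_smul_eq_nsmul ℝ, smul_smul (n : ℝ)⁻¹, inv_mul_cancel₀ hn0, one_smul]
    have : c - (η * n / ((n : ℝ) - 1)) • c = (1 - η * n / ((n : ℝ) - 1)) • c := by module
    rw [this, smul_smul, inv_mul_cancel₀ h.ne', one_smul]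
  refine (htrans c).ne_zero ⟨i, hpi⟩ ?_
  simp [SphereArrangement.grad, hcenter]

end SinkSpheres

theorem mainTheorem2 {d n : ℕ} (hn : 2 ≤ n) (X : Fin n → EuclideanSpace ℝ (Fin d))
    (η : ℝ) (hη₀ : 0 < η) (hη₁ : η < 1 - 1 / (n : ℝ))
    (htrans : (sinkSpheres η X).Transverse)
    (xstar : EuclideanSpace ℝ (Fin d))
    (hmin : ∀ y, sphericalCost η X xstar ≤ sphericalCost η X y)
    (hnd : ∀ᶠ x in 𝓝 xstar, (sinkSpheres η X).QPNondegenerate x) :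
    ∃ U ∈ 𝓝 xstar, ∀ x₀ ∈ U, ∃ N : ℕ, N ≤ 3 ^ ((sinkSpheres η X).Izero xstar).card ∧
      (sinkSpheres η X).run x₀ N = (xstar, true) := by
  have hpos := Ipos_sinkSpheres_nonempty η X hn hη₁ htrans
  have hmin' : ∀ y, (sinkSpheres η X).cost xstar ≤ (sinkSpheres η X).cost y := by
    intro y
    have h := hmin y
    rw [sphericalCost_eq_mul_cost η X hn hη₁, sphericalCost_eq_mul_cost η X hn hη₁] at h
    exact le_of_mul_le_mul_left h (one_sub_mul_div_pos η hn hη₁)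
  rcases Finset.eq_empty_or_nonempty ((sinkSpheres η X).Izero xstar) with h0 | h0
  · exact SphereArrangement.exists_run_eq_of_izero_eq_empty hpos hmin' h0
  · exact SphereArrangement.exists_run_eq_of_izero_nonempty htrans hpos hmin' hnd h0
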